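/- **Lemma 2.2.** Let $\Omega=\{x\in\mathbb R^2:|x|<1\}$, let $\mu>0$ and $\mu+\lambda\ge 0$, and let $$G(x,y)=\frac1{2\pi}\Big(\log|x-y|-\log\Big|\frac{x}{|x|}-|x|\,y\Big|\Big)$$ (the second logarithm being $0$ for $x=0$) be the Dirichlet Green function of $\Delta$ on $\Omega$; for an integrable scalar function or vector field $h$ on $\Omega$ put $G(h)(x)=\int_\Omega G(x,y)h(y)\,dy$. Let $g\in C^1(\Omega)$ be real valued and let $f\in C^1(\Omega;\mathbb R^2)$, with $\nabla g$, $f$ and $\operatorname{div}f$ integrable on $\Omega$. Let $u\in C^2(\Omega;\mathbb R^2)\cap C(\overline\Omega;\mathbb R^2)$ be a classical solution of the Lamé system $$\mu\Delta u+\lambda\nabla\operatorname{div}u=\nabla g+f\ \text{ in }\Omega,\qquad u=0\ \text{ on }\partial\Omega,$$ and suppose that its effective viscous flux $F=(\mu+\lambda)\operatorname{div}u-g$ extends continuously to $\overline\Omega$; the extension is again denoted by $F$. Then, at every point of $\Omega$, the integrals defining $G(\nabla g)$, $G(f)$, $G(x\operatorname{div}f)$ and $G(\operatorname{div}f)$ converge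 absolutely, these functions are differentiable, and $$F=\frac{2\mu}{2\mu+\lambda}A(g)+B(F)+R(f),$$ where, with $ds$ denoting arc length, $$A(g)=\operatorname{div}G(\nabla g)-g,\qquad B(F)=\frac{\lambda}{2\pi(2\mu+\lambda)}\int_{\partial\Omega}F\,ds,$$ $$R(f)=\frac{2(\mu+\lambda)}{2\mu+\lambda}\operatorname{div}G(f)+\frac{\lambda}{2\mu+\lambda}\Big(\operatorname{div}G(x\operatorname{div}f)-x\cdot\nabla G(\operatorname{div}f)-G(\operatorname{div}f)\Big).$$ -/

import Mathlib

namespace LameDisc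

noncomputable section

/-- The Euclidean plane. -/
abbrev Plane : Type := EuclideanSpace ℝ (Fin 2)

/-- The open unit disc `Ω`. -/
def disc : Set Plane := Metric.ball 0 1

/-- The divergence `∂₁ v₁ + ∂₂ v₂` of a planar vector field. -/
def divergence (v : Plane → Plane) (x : Plane) : ℝ :=
  ∑ i : Fin 2, fderiv ℝ v x (EuclideanSpace.single i 1) i

/-- The Dirichlet Green function of the Laplacian on the unit disc,
`(1 / 2π) (log |x - y| - log |x / |x| - |x| y|)`. For `x = 0` the second logarithm has to be
read as its limit `log 1 = 0`, which is the value that Lean assigns to it. -/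
def green (x y : Plane) : ℝ :=
  1 / (2 * Real.pi) *
    (Real.log ‖x - y‖ - Real.log ‖(1 / ‖x‖) • x - ‖x‖ • y‖)

/-- The Green operator `G(h)(x) = ∫_Ω G(x, y) h(y) dy`, on scalar functions and, componentwise,
on vector fields. -/
def greenOp {V : Type*} [NormedAddCommGroup V] [NormedSpace ℝ V] (h : Plane → V) (x : Plane) : V :=
  ∫ y in disc, green x y • h y

/-- The integral defining `G(h)(x)` converges and `G(h)` is differentiable at `x`. -/
def GreenRegularAt {V : Type*} [NormedAddCommGroup V] [NormedSpace ℝ V]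
    (h : Plane → V) (x : Plane) : Prop :=
  MeasureTheory.IntegrableOn (fun y => green x y • h y) disc ∧ DifferentiableAt ℝ (greenOp h) x

/-- The integral over the unit circle with respect to arc length. -/
def boundaryIntegral (h : Plane → ℝ) : ℝ :=
  ∫ θ in (0 : ℝ)..(2 * Real.pi), h !₂[Real.cos θ, Real.sin θ]

/-- `u` is a classical solution of `μ Δu + lam ∇ div u = ∇g + f` in the unit disc with `u = 0` on
the unit circle. -/
structure IsLameSolution (μ lam : ℝ) (u : Plane → Plane) (g : Plane → ℝ) (f : Plane → Plane) :
    Prop where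
  contDiffOn : ContDiffOn ℝ 2 u disc
  continuousOn : ContinuousOn u (closure disc)
  equation : ∀ x ∈ disc,
    μ • Laplacian.laplacian u x + lam • gradient (divergence u) x = gradient g x + f x
  boundary : ∀ x ∈ frontier disc, u x = 0

/-- `F` is the effective viscous flux `(μ + lam) div u - g` in the disc, continuously extended to
the closed disc. -/
structure IsEffectiveViscousFlux (μ lam : ℝ) (u : Plane → Plane) (g F : Plane → ℝ) : Prop where
  eq_flux : ∀ x ∈ disc, F x = (μ + lam) * divergence u x - g x
  continuousOn : ContinuousOn F (closure disc)

/-- The pressure part `A(g) = div G(∇g) - g`. -/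
def pressurePart (g : Plane → ℝ) (x : Plane) : ℝ :=
  divergence (greenOp (gradient g)) x - g x

/-- The boundary part `B(F) = lam / (2π (2μ + lam)) ∫_{∂Ω} F`, a constant. -/
def boundaryPart (μ lam : ℝ) (F : Plane → ℝ) : ℝ :=
  lam / (2 * Real.pi * (2 * μ + lam)) * boundaryIntegral F

/-- The remaining part
`R(f) = 2(μ + lam)/(2μ + lam) div G(f)
  + lam/(2μ + lam) (div G(x div f) - x · ∇G(div f) - G(div f))`. -/
def sourcePart (μ lam : ℝ) (f : Plane → Plane) (x : Plane) : ℝ :=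
  2 * (μ + lam) / (2 * μ + lam) * divergence (greenOp f) x
    + lam / (2 * μ + lam) *
      (divergence (greenOp fun y => divergence f y • y) x
        - inner ℝ x (gradient (greenOp (divergence f)) x)
        - greenOp (divergence f) x)

end

end LameDisc

open LameDisc

/-!
Taking the divergence of the Lamé system, written as `∇F = -μ (Δu - ∇ div u) + f`, gives
`ΔF = div f` in the sense of distributions, because `Δu - ∇ div u` is divergence free. Hence
`F = H + G(div f)` with `H` harmonic, and `H = F` on the unit circle. Moreover
`2 ∇F = Δ(x F) - x div f`, while `(μ + λ) ∇ div u = ∇F + ∇g`, so the Lamé system multiplied by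
`μ + λ` says that the vector field
`E = μ (μ + λ) u - μ G(∇g) - (μ + λ) G(f) + (λ / 2) (x F - G(x div f))`
is harmonic. On the circle it equals `(λ / 2) x H`. These boundary values determine `div E`: with
`H = Re φ` for a holomorphic `φ`, the harmonic extension of `x H` is explicit, and
`div E = (λ / 2) (H + x · ∇H + H(0))`, where `H(0)` is the mean of `F` over the circle. Writing out
`div E` and using `(μ + λ) div u = F + g` gives the formula. Keeping the factor `μ + λ` in `E`
makes the case `μ + λ = 0` no exception.

The right-hand sides are only continuous and integrable, possibly unbounded near the circle, which
is why Laplacians and boundary values have to be taken in a weak sense.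

* `ΔG(h) = h` holds in the sense of distributions (`weakLap_greenOp`), by Fubini and the fundamental
  solution `integral_log_mul_lap`; `G(h)` is differentiable in the disc (`differentiableAt_greenOp`).
* A continuous weakly harmonic function is harmonic (`WeakLap.harmonicOnNhd`).
* `G(h)` vanishes on the circle in the mean: the averages of `|G(h)|` over the circles of radius `r`
  tend to `0` as `r → 1` (`tendsto_circleAverage_abs_greenOp`). By the Poisson formula this is
  enough for uniqueness (`tendsto_zero_of_circleAverage`), and thus for the computation of `div E`
  (`fderiv_add_fderiv_of_boundary`, `pd_add_pd_of_boundary`).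
-/

namespace LameDisc

open MeasureTheory Set Filter Topology
open scoped ContDiff

/-! ### Partial derivatives and test functions on the disc -/

/-- The partial derivative `∂ᵢ a`. -/
noncomputable def pd (i : Fin 2) (a : Plane → ℝ) (x : Plane) : ℝ :=
  fderiv ℝ a x (EuclideanSpace.single i 1)

/-- The Laplacian of a scalar function as `∂₀ ∂₀ a + ∂₁ ∂₁ a`. -/
noncomputable def lap (a : Plane → ℝ) (x : Plane) : ℝ :=
  ∑ i : Fin 2, pd i (pd i a) x

/-- Smooth functions with compact support in the open unit disc. -/
structure IsTest (φ : Plane → ℝ) : Prop where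
  contDiff : ContDiff ℝ ∞ φ
  hasCompactSupport : HasCompactSupport φ
  tsupport_subset : tsupport φ ⊆ disc

lemma isOpen_disc : IsOpen disc := Metric.isOpen_ball

lemma mem_disc {x : Plane} : x ∈ disc ↔ ‖x‖ < 1 := by simp [disc]

lemma disc_mem_nhds {x : Plane} (hx : x ∈ disc) : disc ∈ 𝓝 x := isOpen_disc.mem_nhds hx

lemma pd_congr {i : Fin 2} {a b : Plane → ℝ} {x : Plane} (h : a =ᶠ[𝓝 x] b) :
    pd i a x = pd i b x := by
  simp only [pd, h.fderiv_eq]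

lemma pd_add {i : Fin 2} {a b : Plane → ℝ} {x : Plane} (ha : DifferentiableAt ℝ a x)
    (hb : DifferentiableAt ℝ b x) : pd i (fun y => a y + b y) x = pd i a x + pd i b x := by
  simp [pd, fderiv_fun_add ha hb]

lemma pd_sub {i : Fin 2} {a b : Plane → ℝ} {x : Plane} (ha : DifferentiableAt ℝ a x)
    (hb : DifferentiableAt ℝ b x) : pd i (fun y => a y - b y) x = pd i a x - pd i b x := by
  simp [pd, fderiv_fun_sub ha hb]

lemma pd_const_mul {i : Fin 2} {a : Plane → ℝ} {x : Plane} (c : ℝ)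
    (ha : DifferentiableAt ℝ a x) : pd i (fun y => c * a y) x = c * pd i a x := by
  simp [pd, fderiv_const_mul ha]

lemma pd_mul {i : Fin 2} {a b : Plane → ℝ} {x : Plane} (ha : DifferentiableAt ℝ a x)
    (hb : DifferentiableAt ℝ b x) :
    pd i (fun y => a y * b y) x = pd i a x * b x + a x * pd i b x := by
  simp [pd, fderiv_fun_mul ha hb]; ring

lemma pd_coord (i j : Fin 2) (x : Plane) :
    pd i (fun y : Plane => y j) x = if i = j then 1 else 0 := by
  have : HasFDerivAt (fun y : Plane => y j) (EuclideanSpace.proj j : Plane →L[ℝ] ℝ) x :=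
    (EuclideanSpace.proj j : Plane →L[ℝ] ℝ).hasFDerivAt
  simp [pd, this.fderiv, eq_comm]

lemma pd_pd_eq {a : Plane → ℝ} {x : Plane} (hd : DifferentiableAt ℝ (fderiv ℝ a) x)
    (i j : Fin 2) : pd i (pd j a) x
      = fderiv ℝ (fderiv ℝ a) x (EuclideanSpace.single i 1) (EuclideanSpace.single j 1) := by
  have h : HasFDerivAt (pd j a) ((fderiv ℝ (fderiv ℝ a) x).flip (EuclideanSpace.single j 1)) x := by
    have h := hd.hasFDerivAt.clm_apply (hasFDerivAt_const (EuclideanSpace.single j (1 : ℝ)) x)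
    refine h.congr_fderiv ?_
    ext v; simp
  rw [pd, h.fderiv]; rfl

lemma contDiff_pd {i : Fin 2} {a : Plane → ℝ} (ha : ContDiff ℝ ∞ a) : ContDiff ℝ ∞ (pd i a) :=
  (ha.fderiv_right (m := ∞) (by simp)).clm_apply contDiff_const

lemma contDiffOn_pd {i : Fin 2} {a : Plane → ℝ} {m n : WithTop ℕ∞} (ha : ContDiffOn ℝ n a disc)
    (hmn : m + 1 ≤ n) : ContDiffOn ℝ m (pd i a) disc :=
  (ha.fderiv_of_isOpen isOpen_disc hmn).clm_apply contDiffOn_const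

lemma ContDiffOn.differentiableAt_disc {V : Type*} [NormedAddCommGroup V] [NormedSpace ℝ V]
    {a : Plane → V} {n : WithTop ℕ∞} (ha : ContDiffOn ℝ n a disc)
    (hn : n ≠ 0) {x : Plane} (hx : x ∈ disc) : DifferentiableAt ℝ a x :=
  (ha.differentiableOn hn).differentiableAt (disc_mem_nhds hx)

lemma tsupport_pd_subset (i : Fin 2) (a : Plane → ℝ) : tsupport (pd i a) ⊆ tsupport a :=
  (closure_mono fun x hx => by
    have : fderiv ℝ a x ≠ 0 := fun h => hx (by simp [pd, h])
    exact support_fderiv_subset ℝ this).trans_eq isClosed_closure.closure_eq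

namespace IsTest

variable {φ : Plane → ℝ}

lemma pd (h : IsTest φ) (i : Fin 2) : IsTest (pd i φ) :=
  ⟨contDiff_pd h.contDiff,
    h.hasCompactSupport.of_isClosed_subset (isClosed_tsupport _) (tsupport_pd_subset i φ),
    (tsupport_pd_subset i φ).trans h.tsupport_subset⟩

lemma add {ψ : Plane → ℝ} (h : IsTest φ) (h' : IsTest ψ) : IsTest (fun x => φ x + ψ x) := by
  refine ⟨h.contDiff.add h'.contDiff, h.hasCompactSupport.add h'.hasCompactSupport, ?_⟩
  exact (tsupport_add φ ψ).trans (union_subset h.tsupport_subset h'.tsupport_subset)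

lemma mul_left (h : IsTest φ) {b : Plane → ℝ} (hb : ContDiff ℝ ∞ b) :
    IsTest (fun x => b x * φ x) :=
  ⟨hb.mul h.contDiff, h.hasCompactSupport.mul_left,
    (tsupport_mul_subset_right (f := b) (g := φ)).trans h.tsupport_subset⟩

lemma differentiable (h : IsTest φ) : Differentiable ℝ φ := h.contDiff.differentiable (by simp)

lemma lap (h : IsTest φ) : IsTest (lap φ) := by
  have := ((h.pd 0).pd 0).add ((h.pd 1).pd 1)
  convert this using 1
  ext x
  simp [LameDisc.lap, Fin.sum_univ_two]

lemma eq_zero_of_notMem (h : IsTest φ) {x : Plane} (hx : x ∉ disc) : φ x = 0 :=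
  image_eq_zero_of_notMem_tsupport fun h' => hx (h.tsupport_subset h')

lemma continuous_mul (h : IsTest φ) {a : Plane → ℝ} (ha : ContinuousOn a disc) :
    Continuous fun x => a x * φ x := by
  rw [continuous_iff_continuousAt]
  intro x
  by_cases hx : x ∈ disc
  · exact (ha.continuousAt (disc_mem_nhds hx)).mul h.contDiff.continuous.continuousAt
  · have h0 : φ =ᶠ[𝓝 x] 0 := notMem_tsupport_iff_eventuallyEq.1 fun h' => hx (h.tsupport_subset h')
    exact (continuousAt_const (y := (0 : ℝ))).congr (h0.mono fun y hy => by simp [hy])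

lemma integrable_mul (h : IsTest φ) {a : Plane → ℝ} (ha : ContinuousOn a disc) :
    Integrable fun x => a x * φ x :=
  (h.continuous_mul ha).integrable_of_hasCompactSupport h.hasCompactSupport.mul_left

/-- Integration by parts against a test function. -/
lemma integral_mul_pd (h : IsTest φ) {a : Plane → ℝ} (ha : ContDiffOn ℝ 1 a disc) (i : Fin 2) :
    ∫ x, a x * LameDisc.pd i φ x = -∫ x, LameDisc.pd i a x * φ x := by
  -- The product `a φ` is differentiable on the whole plane, although `a` need not be, so the
  -- claim is that its derivative has integral zero.
  have hda : ∀ x ∈ disc, DifferentiableAt ℝ a x := fun x hx =>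
    LameDisc.ContDiffOn.differentiableAt_disc ha (by simp) hx
  have hpa : ContinuousOn (LameDisc.pd i a) disc :=
    (contDiffOn_pd (m := 0) ha (by simp)).continuousOn
  have hprod : ∀ x,
      HasFDerivAt (fun x => a x * φ x) (a x • fderiv ℝ φ x + φ x • fderiv ℝ a x) x := by
    intro x
    by_cases hx : x ∈ disc
    · exact (hda x hx).hasFDerivAt.mul h.differentiable.differentiableAt.hasFDerivAt
    · have h0 : φ =ᶠ[𝓝 x] 0 :=
        notMem_tsupport_iff_eventuallyEq.1 fun h' => hx (h.tsupport_subset h')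
      have h1 : (fun x => a x * φ x) =ᶠ[𝓝 x] fun _ => 0 := h0.mono fun y hy => by simp [hy]
      have h2 : fderiv ℝ φ x = 0 := by rw [h0.fderiv_eq]; simp
      rw [h2, h0.self_of_nhds]
      simpa using (hasFDerivAt_const (0 : ℝ) x).congr_of_eventuallyEq h1
  have h1 := (h.pd i).integrable_mul ha.continuousOn
  have h2 := h.integrable_mul hpa
  have hpt : ∀ x, fderiv ℝ (fun x => a x * φ x) x (EuclideanSpace.single i 1)
      = a x * LameDisc.pd i φ x + LameDisc.pd i a x * φ x := by
    intro x; rw [(hprod x).fderiv]; simp [LameDisc.pd]; ring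
  have key := integral_mul_fderiv_eq_neg_fderiv_mul_of_integrable (μ := (volume : Measure Plane))
    (f := fun _ => (1 : ℝ)) (g := fun x => a x * φ x) (v := EuclideanSpace.single i 1)
    (by simp) (by simp only [hpt, one_mul]; exact h1.add h2)
    (by simpa using h.integrable_mul ha.continuousOn)
    (by simp) (fun x _ => (hprod x).differentiableAt)
  simp only [hpt, one_mul, fderiv_fun_const, Pi.zero_apply, _root_.zero_apply, zero_mul,
    integral_zero, neg_zero] at key
  rw [integral_add h1 h2] at key
  linarith

lemma pd_comm (h : IsTest φ) (i j : Fin 2) :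
    LameDisc.pd i (LameDisc.pd j φ) = LameDisc.pd j (LameDisc.pd i φ) := by
  ext x
  have hd : DifferentiableAt ℝ (fderiv ℝ φ) x :=
    ((h.contDiff.fderiv_right (m := ∞) (by simp)).differentiable (by simp)).differentiableAt
  rw [pd_pd_eq hd, pd_pd_eq hd]
  exact h.contDiff.contDiffAt.isSymmSndFDerivAt (by simpa using ENat.LEInfty.out) _ _

end IsTest

/-- `Δ a = h` in the sense of distributions on the disc. -/
def WeakLap (a h : Plane → ℝ) : Prop :=
  ∀ φ, IsTest φ → ∫ x, a x * lap φ x = ∫ x, h x * φ x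

lemma WeakLap.add {a b h k : Plane → ℝ} (ha : WeakLap a h) (hb : WeakLap b k)
    (hac : ContinuousOn a disc) (hbc : ContinuousOn b disc) (hhc : ContinuousOn h disc)
    (hkc : ContinuousOn k disc) : WeakLap (fun x => a x + b x) (fun x => h x + k x) := by
  intro φ hφ
  simp only [add_mul]
  rw [integral_add (hφ.lap.integrable_mul hac) (hφ.lap.integrable_mul hbc),
    integral_add (hφ.integrable_mul hhc) (hφ.integrable_mul hkc), ha φ hφ, hb φ hφ]

lemma WeakLap.const_mul {a h : Plane → ℝ} (ha : WeakLap a h) (c : ℝ) :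
    WeakLap (fun x => c * a x) (fun x => c * h x) := by
  intro φ hφ
  simp only [mul_assoc]
  rw [integral_const_mul, integral_const_mul, ha φ hφ]

lemma WeakLap.sub {a b h k : Plane → ℝ} (ha : WeakLap a h) (hb : WeakLap b k)
    (hac : ContinuousOn a disc) (hbc : ContinuousOn b disc) (hhc : ContinuousOn h disc)
    (hkc : ContinuousOn k disc) : WeakLap (fun x => a x - b x) (fun x => h x - k x) := by
  intro φ hφ
  simp only [sub_mul]
  rw [integral_sub (hφ.lap.integrable_mul hac) (hφ.lap.integrable_mul hbc),
    integral_sub (hφ.integrable_mul hhc) (hφ.integrable_mul hkc), ha φ hφ, hb φ hφ]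

lemma WeakLap.congr_right {a h k : Plane → ℝ} (ha : WeakLap a h) (hk : EqOn h k disc) :
    WeakLap a k := by
  intro φ hφ
  rw [ha φ hφ]
  congr 1 with x
  by_cases hx : x ∈ disc
  · rw [hk hx]
  · simp [hφ.eq_zero_of_notMem hx]

lemma integral_mul_lap {φ : Plane → ℝ} (hφ : IsTest φ) {a : Plane → ℝ}
    (ha : ContinuousOn a disc) :
    ∫ x, a x * lap φ x = ∑ i : Fin 2, ∫ x, a x * pd i (pd i φ) x := by
  simp only [lap, Finset.mul_sum]
  exact integral_finsetSum _ fun i _ => ((hφ.pd i).pd i).integrable_mul ha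

lemma weakLap_lap {a : Plane → ℝ} (ha : ContDiffOn ℝ 2 a disc) : WeakLap a (lap a) := by
  intro φ hφ
  have h1 : ∀ i, ContDiffOn ℝ 1 (pd i a) disc := fun i => contDiffOn_pd ha (by norm_num)
  have h0 : ∀ i, ContinuousOn (pd i (pd i a)) disc := fun i =>
    (contDiffOn_pd (m := 0) (h1 i) (by norm_num)).continuousOn
  rw [integral_mul_lap hφ ha.continuousOn]
  simp only [lap, Finset.sum_mul]
  rw [integral_finsetSum _ fun i _ => hφ.integrable_mul (h0 i)]
  refine Finset.sum_congr rfl fun i _ => ?_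
  rw [(hφ.pd i).integral_mul_pd (ha.of_le (by norm_num)), hφ.integral_mul_pd (h1 i), neg_neg]

/-- `Δ (xⱼ a) = 2 ∂ⱼ a + xⱼ Δ a` in the sense of distributions. -/
lemma WeakLap.coord_mul {a h : Plane → ℝ} (hw : WeakLap a h) (ha : ContDiffOn ℝ 1 a disc)
    (hh : ContinuousOn h disc) (j : Fin 2) :
    WeakLap (fun x => x j * a x) (fun x => 2 * pd j a x + x j * h x) := by
  intro φ hφ
  have hcd : ContDiff ℝ ∞ (fun x : Plane => x j) :=
    (EuclideanSpace.proj j : Plane →L[ℝ] ℝ).contDiff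
  have hcoord : ∀ x : Plane, DifferentiableAt ℝ (fun x : Plane => x j) x := fun x =>
    (hcd.differentiable (by simp)).differentiableAt
  have hψ : IsTest fun x => x j * φ x := hφ.mul_left hcd
  have e1 : ∀ i, pd i (fun x => x j * φ x) = fun x =>
      (if i = j then 1 else 0) * φ x + x j * pd i φ x := by
    intro i; ext x
    rw [pd_mul (hcoord x) hφ.differentiable.differentiableAt, pd_coord]
  have e2 : ∀ x, lap (fun x => x j * φ x) x = 2 * pd j φ x + x j * lap φ x := by
    intro x
    have e3 : ∀ i, pd i (pd i (fun x => x j * φ x)) x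
        = 2 * ((if i = j then 1 else 0) * pd i φ x) + x j * pd i (pd i φ) x := by
      intro i
      rw [e1, pd_add (a := fun x => (if i = j then 1 else 0) * φ x) (b := fun x => x j * pd i φ x)
          (hφ.differentiable.differentiableAt.const_mul _)
          ((hcoord x).mul (hφ.pd i).differentiable.differentiableAt),
        pd_const_mul _ hφ.differentiable.differentiableAt,
        pd_mul (hcoord x) (hφ.pd i).differentiable.differentiableAt, pd_coord]
      ring
    simp only [lap, e3, Fin.sum_univ_two]
    fin_cases j <;> simp <;> ring
  have h1 := hw _ hψ
  have h2 := hφ.integral_mul_pd ha j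
  have hpa : ContinuousOn (pd j a) disc := (contDiffOn_pd (m := 0) ha (by simp)).continuousOn
  have hxa : ContinuousOn (fun x : Plane => x j * a x) disc :=
    hcd.continuous.continuousOn.mul ha.continuousOn
  have hxh : ContinuousOn (fun x : Plane => x j * h x) disc :=
    hcd.continuous.continuousOn.mul hh
  have e4 : ∀ x, a x * lap (fun x => x j * φ x) x = 2 * (a x * pd j φ x) + x j * a x * lap φ x := by
    intro x; rw [e2]; ring
  simp only [e4] at h1
  rw [integral_add (((hφ.pd j).integrable_mul ha.continuousOn).const_mul 2)
    (hφ.lap.integrable_mul hxa), integral_const_mul, h2] at h1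
  have e5 : ∀ x, (2 * pd j a x + x j * h x) * φ x = 2 * (pd j a x * φ x) + x j * h x * φ x := by
    intro x; ring
  simp only [e5]
  rw [integral_add ((hφ.integrable_mul hpa).const_mul 2) (hφ.integrable_mul hxh),
    integral_const_mul]
  have e6 : ∀ x, h x * (x j * φ x) = x j * h x * φ x := fun x => by ring
  simp only [e6] at h1
  linarith

/-! ### The kernels -/

/-- The regular part of the Green function, `log |x / |x| - |x| y|`, in a form that is smooth in
`x` at the origin. -/
noncomputable def regularPart (x y : Plane) : ℝ :=
  1 / 2 * Real.log (1 - 2 * inner ℝ x y + ‖x‖ ^ 2 * ‖y‖ ^ 2)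

lemma log_norm_reflect (x y : Plane) :
    Real.log ‖(1 / ‖x‖) • x - ‖x‖ • y‖ = regularPart x y := by
  rcases eq_or_ne x 0 with rfl | hx
  · simp [regularPart]
  · have hx' : ‖x‖ ≠ 0 := norm_ne_zero_iff.2 hx
    have : ‖(1 / ‖x‖) • x - ‖x‖ • y‖ ^ 2 = 1 - 2 * inner ℝ x y + ‖x‖ ^ 2 * ‖y‖ ^ 2 := by
      rw [norm_sub_sq_real, norm_smul, norm_smul, real_inner_smul_left, real_inner_smul_right]
      simp only [norm_div, norm_one, norm_norm]
      field_simp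
    rw [regularPart, ← this, Real.log_pow]
    push_cast; ring

lemma green_eq (x y : Plane) :
    green x y = 1 / (2 * Real.pi) * (Real.log ‖x - y‖ - regularPart x y) := by
  rw [green, log_norm_reflect]

/-- For `x`, `y` in the disc the argument of the regular part stays away from zero. -/
lemma one_sub_norm_sq_le (x y : Plane) (hx : ‖x‖ ≤ 1) (hy : ‖y‖ ≤ 1) :
    (1 - ‖x‖) ^ 2 ≤ 1 - 2 * inner ℝ x y + ‖x‖ ^ 2 * ‖y‖ ^ 2 := by
  have h1 := real_inner_le_norm x y
  have h2 : ‖x‖ * ‖y‖ ≤ ‖x‖ := mul_le_of_le_one_right (norm_nonneg _) hy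
  have h3 : 0 ≤ ‖x‖ * ‖y‖ := by positivity
  nlinarith

lemma regularPart_arg_le (x y : Plane) (hx : ‖x‖ ≤ 1) (hy : ‖y‖ ≤ 1) :
    1 - 2 * inner ℝ x y + ‖x‖ ^ 2 * ‖y‖ ^ 2 ≤ 4 := by
  have h1 := (abs_le.1 (abs_real_inner_le_norm x y)).1
  have h2 : ‖x‖ * ‖y‖ ≤ 1 := mul_le_one₀ hx (norm_nonneg _) hy
  have h3 : 0 ≤ ‖x‖ * ‖y‖ := by positivity
  nlinarith

/-- The regular part is bounded for `x` in a smaller disc. -/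
lemma abs_regularPart_le {r : ℝ} (hr : r < 1) {x y : Plane} (hx : ‖x‖ ≤ r) (hy : ‖y‖ ≤ 1) :
    |regularPart x y| ≤ 2 + |Real.log (1 - r)| := by
  have h1 := one_sub_norm_sq_le x y (hx.trans hr.le) hy
  have h2 := regularPart_arg_le x y (hx.trans hr.le) hy
  have h3 : (1 - r) ^ 2 ≤ (1 - ‖x‖) ^ 2 := by gcongr
  have h4 : 0 < (1 - r) ^ 2 := pow_pos (by linarith) 2
  have h5 : Real.log ((1 - r) ^ 2) ≤ Real.log (1 - 2 * inner ℝ x y + ‖x‖ ^ 2 * ‖y‖ ^ 2) :=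
    Real.log_le_log h4 (h3.trans h1)
  have h6 : Real.log (1 - 2 * inner ℝ x y + ‖x‖ ^ 2 * ‖y‖ ^ 2) ≤ 4 :=
    (Real.log_le_sub_one_of_pos (h4.trans_le (h3.trans h1))).trans (by linarith)
  rw [Real.log_pow] at h5
  push_cast at h5
  have h7 := neg_abs_le (Real.log (1 - r))
  rw [regularPart, abs_le]
  constructor <;> linarith [abs_nonneg (Real.log (1 - r))]

lemma abs_log_le {t T : ℝ} (ht : 0 ≤ t) (htT : t ≤ T) : |Real.log t| ≤ T + t⁻¹ := by
  rcases ht.eq_or_lt with rfl | ht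
  · simpa using htT
  · have h1 := Real.log_le_sub_one_of_pos ht
    have h2 := Real.log_le_sub_one_of_pos (inv_pos.2 ht)
    rw [Real.log_inv] at h2
    have := inv_pos.2 ht
    rw [abs_le]; constructor <;> linarith

lemma finrank_plane : Module.finrank ℝ Plane = 2 := by simp

lemma integrableOn_norm_inv (R : ℝ) :
    IntegrableOn (fun z : Plane => ‖z‖⁻¹) (Metric.ball 0 R) := by
  refine integrableOn_ball_of_norm_le_rpow (C := 1) (α := 1) (by simp) (by simp) ?_ ?_
  · filter_upwards with x
    simp [Real.rpow_neg_one]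
  · exact (measurable_norm.inv).aestronglyMeasurable

lemma measurable_green : Measurable fun p : Plane × Plane => green p.1 p.2 := by
  unfold green; fun_prop

/-- The bound of the Green function by a multiple of `1 + 1 / |x - y|`, uniform for `x` in a
smaller disc. -/
lemma exists_green_le {r : ℝ} (hr : r < 1) : ∃ C, 0 ≤ C ∧ ∀ x y : Plane, ‖x‖ ≤ r → ‖y‖ ≤ 1 →
    |green x y| ≤ C + ‖x - y‖⁻¹ := by
  refine ⟨4 + |Real.log (1 - r)|, by positivity, fun x y hx hy => ?_⟩
  rw [green_eq, abs_mul]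
  have h1 := abs_regularPart_le hr hx hy
  have h2 : ‖x - y‖ ≤ 2 := (norm_sub_le x y).trans (by linarith)
  have h3 := abs_log_le (norm_nonneg _) h2
  have h4 := abs_sub (Real.log ‖x - y‖) (regularPart x y)
  have h5 : |1 / (2 * Real.pi)| ≤ 1 := by
    rw [abs_of_pos (by positivity), div_le_one (by positivity)]
    linarith [Real.pi_gt_three]
  calc _ ≤ 1 * |Real.log ‖x - y‖ - regularPart x y| := by gcongr
    _ ≤ _ := by linarith

/-- A function on the disc that is integrable, and bounded near `x`, stays integrable after
multiplication with `1 / |x - y|`. -/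
lemma integrableOn_norm_inv_mul {h : Plane → ℝ} (hc : ContinuousOn h disc)
    (hi : IntegrableOn h disc) {x : Plane} (hx : x ∈ disc) :
    IntegrableOn (fun y => ‖x - y‖⁻¹ * h y) disc := by
  obtain ⟨ρ, hρ, hρd⟩ := Metric.nhds_basis_closedBall.mem_iff.1 (disc_mem_nhds hx)
  obtain ⟨M, hM⟩ := (isCompact_closedBall x ρ).exists_bound_of_continuousOn (hc.mono hρd)
  have hM0 : 0 ≤ M := (norm_nonneg _).trans (hM x (Metric.mem_closedBall_self hρ.le))
  have hk : Integrable (fun y => (Metric.ball (0 : Plane) ρ).indicator (fun z => ‖z‖⁻¹) (x - y)) :=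
    ((integrableOn_norm_inv ρ).integrable_indicator
      Metric.isOpen_ball.measurableSet).comp_sub_left x
  refine Integrable.mono' ((hk.integrableOn (s := disc)).const_mul M |>.add (hi.norm.const_mul ρ⁻¹))
    ((by fun_prop : Measurable fun y => ‖x - y‖⁻¹).aestronglyMeasurable.mul hi.1)
    (ae_of_all _ fun y => ?_)
  simp only [norm_mul, norm_inv, norm_norm, Pi.add_apply]
  by_cases hy : ‖x - y‖ < ρ
  · have h1 : ‖h y‖ ≤ M := hM y (by rw [mem_closedBall_iff_norm, norm_sub_rev]; exact hy.le)
    rw [indicator_of_mem (by simpa using hy)]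
    have : ‖x - y‖⁻¹ * ‖h y‖ ≤ M * ‖x - y‖⁻¹ := by rw [mul_comm]; gcongr
    have : 0 ≤ ρ⁻¹ * ‖h y‖ := by positivity
    linarith
  · rw [indicator_of_notMem (by simpa using hy)]
    push Not at hy
    have : ‖x - y‖⁻¹ * ‖h y‖ ≤ ρ⁻¹ * ‖h y‖ := by gcongr
    simpa using this

lemma integrableOn_green_mul {h : Plane → ℝ} (hc : ContinuousOn h disc)
    (hi : IntegrableOn h disc) {x : Plane} (hx : x ∈ disc) :
    IntegrableOn (fun y => green x y * h y) disc := by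
  obtain ⟨C, hC0, hC⟩ := exists_green_le (mem_disc.1 hx)
  refine Integrable.mono' ((hi.norm.const_mul C).add (integrableOn_norm_inv_mul hc hi hx).norm)
    ((measurable_green.comp (measurable_const.prodMk measurable_id)).aestronglyMeasurable.mul
      hi.1) ?_
  filter_upwards [ae_restrict_mem isOpen_disc.measurableSet] with y hy
  have := hC x y le_rfl (mem_disc.1 hy).le
  simp only [norm_mul, Pi.add_apply, norm_inv, norm_norm]
  rw [← add_mul]
  gcongr
  exact this

/-- The Green kernel against an integrable function and a bounded function supported in a smaller
disc is integrable on the product. -/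
lemma integrable_green_prod {h ψ : Plane → ℝ} (hi : IntegrableOn h disc) (hψ : Continuous ψ)
    (hψc : HasCompactSupport ψ) (hψd : tsupport ψ ⊆ disc) :
    Integrable (fun p : Plane × Plane => green p.1 p.2 * h p.2 * ψ p.1)
      (volume.prod (volume.restrict disc)) := by
  obtain ⟨r, hr, hr'⟩ : ∃ r < 1, ∀ x, ψ x ≠ 0 → ‖x‖ ≤ r := by
    rcases (tsupport ψ).eq_empty_or_nonempty with he | hne
    · refine ⟨0, one_pos, fun x hx => absurd (subset_tsupport ψ hx) (by simp [he])⟩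
    · obtain ⟨z, hz, hmax⟩ := hψc.isCompact.exists_isMaxOn hne continuous_norm.continuousOn
      exact ⟨‖z‖, mem_disc.1 (hψd hz), fun x hx => hmax (subset_tsupport ψ hx)⟩
  obtain ⟨C, hC0, hC⟩ := exists_green_le hr
  obtain ⟨M, hM⟩ := hψc.exists_bound_of_continuous hψ
  have hM0 : 0 ≤ M := (norm_nonneg _).trans (hM 0)
  have hk : Integrable ((Metric.ball (0 : Plane) 2).indicator fun z => M * (C + ‖z‖⁻¹)) :=
    IntegrableOn.integrable_indicator
      (((integrableOn_const measure_ball_lt_top.ne).add (integrableOn_norm_inv 2)).const_mul M)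
      Metric.isOpen_ball.measurableSet
  have hconv := Integrable.convolution_integrand (μ := (volume : Measure Plane))
    (ν := volume.restrict disc) (ContinuousLinearMap.mul ℝ ℝ) hi.norm hk
  refine hconv.mono' ?_ ?_
  · refine (measurable_green.aestronglyMeasurable.mul ?_).mul
      (hψ.measurable.comp measurable_fst).aestronglyMeasurable
    exact hi.1.comp_snd
  · have hmem : ∀ᵐ p : Plane × Plane ∂volume.prod (volume.restrict disc), p.2 ∈ disc :=
      Measure.quasiMeasurePreserving_snd.ae (ae_restrict_mem isOpen_disc.measurableSet)
    filter_upwards [hmem] with p hp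
    have hp1 := mem_disc.1 hp
    by_cases h0 : ψ p.1 = 0
    · simp only [h0, mul_zero, norm_zero, ContinuousLinearMap.mul_apply']
      refine mul_nonneg (norm_nonneg _) (indicator_nonneg (fun z _ => by positivity) _)
    · have hx := hr' _ h0
      have hmem2 : p.1 - p.2 ∈ Metric.ball (0 : Plane) 2 := by
        rw [mem_ball_zero_iff]
        exact (norm_sub_le _ _).trans_lt (by linarith)
      rw [ContinuousLinearMap.mul_apply', indicator_of_mem hmem2, norm_mul, norm_mul]
      have h1 := hC _ _ hx hp1.le
      have h2 := hM p.1
      calc ‖green p.1 p.2‖ * ‖h p.2‖ * ‖ψ p.1‖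
          ≤ (C + ‖p.1 - p.2‖⁻¹) * ‖h p.2‖ * M := by gcongr; exact h1
        _ = _ := by ring

/-! ### The fundamental solution -/

/-- The regularisation `½ log (|z|² + c)` of `log |z|`. -/
noncomputable def logReg (c : ℝ) (z : Plane) : ℝ := 1 / 2 * Real.log (‖z‖ ^ 2 + c)

lemma contDiff_logReg {c : ℝ} (hc : 0 < c) : ContDiff ℝ ∞ (logReg c) :=
  contDiff_const.mul (((contDiff_norm_sq ℝ).add contDiff_const).log fun z => by positivity)

lemma hasFDerivAt_logReg {c : ℝ} (hc : 0 < c) (z : Plane) :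
    HasFDerivAt (logReg c) ((‖z‖ ^ 2 + c)⁻¹ • innerSL ℝ z) z := by
  have h1 : HasFDerivAt (fun z : Plane => ‖z‖ ^ 2 + c) (2 • innerSL ℝ z) z := by
    simpa using (hasFDerivAt_id z).norm_sq.add_const c
  refine ((h1.log (by positivity)).const_mul (1 / 2)).congr_fderiv ?_
  ext v
  simp
  ring

lemma hasFDerivAt_logReg_sub {c : ℝ} (hc : 0 < c) (x y : Plane) :
    HasFDerivAt (fun x => logReg c (x - y)) ((‖x - y‖ ^ 2 + c)⁻¹ • innerSL ℝ (x - y)) x :=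
  (HasFDerivAt.comp (f := fun x => x - y) x (hasFDerivAt_logReg hc (x - y))
    (hasFDerivAt_sub_const y)).congr_fderiv (by ext; simp)

lemma logReg_zero (z : Plane) : logReg 0 z = Real.log ‖z‖ := by
  simp [logReg, Real.log_pow]

lemma tendsto_logReg {ι : Type*} {l : Filter ι} {c : ι → ℝ} (hc : Tendsto c l (𝓝 0)) {z : Plane}
    (hz : z ≠ 0) : Tendsto (fun n => logReg (c n) z) l (𝓝 (Real.log ‖z‖)) := by
  rw [← logReg_zero]
  have hpos : ‖z‖ ^ 2 + 0 ≠ 0 := by have := norm_pos_iff.2 hz; positivity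
  exact ((tendsto_const_nhds.add hc).log hpos).const_mul _

lemma abs_logReg_le {c : ℝ} (hc0 : 0 ≤ c) (hc1 : c ≤ 1) {z : Plane} (hz : z ≠ 0)
    (hz2 : ‖z‖ ≤ 2) : |logReg c z| ≤ 2 + ‖z‖⁻¹ := by
  have hz0 := norm_pos_iff.2 hz
  have h1 : Real.log (‖z‖ ^ 2) ≤ Real.log (‖z‖ ^ 2 + c) :=
    Real.log_le_log (by positivity) (by linarith)
  have h2 : Real.log (‖z‖ ^ 2 + c) ≤ ‖z‖ ^ 2 + c - 1 := Real.log_le_sub_one_of_pos (by positivity)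
  have h3 := (abs_le.1 (abs_log_le hz0.le hz2)).1
  rw [Real.log_pow] at h1
  push_cast at h1
  have := inv_pos.2 hz0
  rw [logReg, abs_le]
  constructor <;> nlinarith

lemma lap_logReg_sub {c : ℝ} (hc : 0 < c) (x y : Plane) :
    lap (fun x => logReg c (x - y)) x = 2 * c / (‖x - y‖ ^ 2 + c) ^ 2 := by
  have h1 : ∀ i, pd i (fun x => logReg c (x - y))
      = fun x => (x i - y i) * (‖x - y‖ ^ 2 + c)⁻¹ := by
    intro i; ext x
    rw [pd, (hasFDerivAt_logReg_sub hc x y).fderiv]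
    simp [EuclideanSpace.inner_single_right]
    ring
  have h2 : ∀ i, pd i (pd i (fun x => logReg c (x - y))) x
      = (‖x - y‖ ^ 2 + c)⁻¹ - 2 * (x i - y i) ^ 2 / (‖x - y‖ ^ 2 + c) ^ 2 := by
    intro i
    rw [h1]
    have e1 : HasFDerivAt (fun x : Plane => x i - y i) (EuclideanSpace.proj i : Plane →L[ℝ] ℝ) x :=
      (EuclideanSpace.proj i : Plane →L[ℝ] ℝ).hasFDerivAt.sub_const _
    have e2 : HasFDerivAt (fun x : Plane => ‖x - y‖ ^ 2 + c) (2 • innerSL ℝ (x - y)) x := by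
      simpa using ((hasFDerivAt_id x).sub_const y).norm_sq.add_const c
    have hne : ‖x - y‖ ^ 2 + c ≠ 0 := by positivity
    have e3 := (hasDerivAt_inv hne).comp_hasFDerivAt x e2
    have e4 : HasFDerivAt (fun x : Plane => (x i - y i) * (‖x - y‖ ^ 2 + c)⁻¹) _ x := e1.mul e3
    rw [pd, e4.fderiv]
    simp [EuclideanSpace.inner_single_right]
    ring
  have h3 : ‖x - y‖ ^ 2 = (x 0 - y 0) ^ 2 + (x 1 - y 1) ^ 2 := by
    rw [EuclideanSpace.norm_sq_eq]; simp [Fin.sum_univ_two]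
  have hne : ‖x - y‖ ^ 2 + c ≠ 0 := by positivity
  simp only [lap, h2, Fin.sum_univ_two]
  field_simp
  rw [h3]; ring

/-- The normalised peak function `(1 / π) (1 + |z|²)⁻²`. -/
noncomputable def peak (z : Plane) : ℝ := 1 / Real.pi * ((1 + ‖z‖ ^ 2) ^ 2)⁻¹

lemma integral_peak : ∫ z, peak z = 1 := by
  have h0 := integral_fun_norm_addHaar (volume : Measure Plane)
    (fun t : ℝ => 1 / Real.pi * ((1 + t ^ 2) ^ 2)⁻¹)
  have hvol : (volume : Measure Plane).real (Metric.ball 0 1) = Real.pi := by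
    rw [Measure.real, EuclideanSpace.volume_ball_fin_two]
    simp [Real.pi_pos.le]
  have hder : ∀ t : ℝ, HasDerivAt (fun t : ℝ => -(1 / (2 * Real.pi)) * (1 + t ^ 2)⁻¹)
      (t * (1 / Real.pi * ((1 + t ^ 2) ^ 2)⁻¹)) t := by
    intro t
    have h1 : HasDerivAt (fun t : ℝ => 1 + t ^ 2) (2 * t) t := by
      simpa using (hasDerivAt_pow 2 t).const_add 1
    have h2 : (1 + t ^ 2) ≠ 0 := by positivity
    refine ((h1.inv h2).const_mul _).congr_deriv ?_
    field_simp
  have hlim : Tendsto (fun t : ℝ => -(1 / (2 * Real.pi)) * (1 + t ^ 2)⁻¹) atTop (𝓝 0) := by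
    have : Tendsto (fun t : ℝ => 1 + t ^ 2) atTop atTop :=
      tendsto_atTop_add_const_left _ _ (tendsto_pow_atTop (by norm_num))
    simpa using this.inv_tendsto_atTop.const_mul (-(1 / (2 * Real.pi)))
  have hint := integral_Ioi_of_hasDerivAt_of_nonneg' (a := 0)
    (fun t _ => hder t) (fun t ht => by have : 0 < t := ht; positivity) hlim
  unfold peak
  rw [h0, hvol, finrank_plane]
  simp only [Nat.reduceSub, pow_one, smul_eq_mul, nsmul_eq_mul]
  rw [hint]
  have := Real.pi_ne_zero
  field_simp
  norm_num

lemma tendsto_norm_sq_mul_peak :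
    Tendsto (fun z : Plane => ‖z‖ ^ 2 * peak z) (Bornology.cobounded Plane) (𝓝 0) := by
  have h1 : Tendsto (fun z : Plane => 1 / Real.pi * (1 + ‖z‖ ^ 2)⁻¹) (Bornology.cobounded Plane)
      (𝓝 0) := by
    have : Tendsto (fun t : ℝ => 1 + t ^ 2) atTop atTop :=
      tendsto_atTop_add_const_left _ _ (tendsto_pow_atTop (by norm_num))
    simpa using
      ((this.comp tendsto_norm_cobounded_atTop).inv_tendsto_atTop).const_mul (1 / Real.pi)
  refine squeeze_zero (fun z => by unfold peak; positivity) (fun z => ?_) h1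
  unfold peak
  have : ‖z‖ ^ 2 * (1 / Real.pi * ((1 + ‖z‖ ^ 2) ^ 2)⁻¹)
      = 1 / Real.pi * (1 + ‖z‖ ^ 2)⁻¹ * (‖z‖ ^ 2 / (1 + ‖z‖ ^ 2)) := by field_simp
  rw [this]
  refine mul_le_of_le_one_right (by positivity) ?_
  rw [div_le_one (by positivity)]; linarith

/-- `(1 / 2π) log |x - y|` is a fundamental solution of the Laplacian. -/
lemma integral_log_mul_lap {φ : Plane → ℝ} (hφ : IsTest φ) {y : Plane} (hy : y ∈ disc) :
    ∫ x, Real.log ‖x - y‖ * lap φ x = 2 * Real.pi * φ y := by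
  -- With `c = k⁻²` the Laplacian `2 c / (|z|² + c)²` of `logReg c` is `2π` times the approximate
  -- identity `k² peak (k z)`.
  set c : ℝ → ℝ := fun k => (k ^ 2)⁻¹ with hc
  have hcpos : ∀ᶠ k : ℝ in atTop, 0 < c k ∧ c k ≤ 1 := by
    filter_upwards [eventually_ge_atTop 1] with k hk
    have : 1 ≤ k ^ 2 := one_le_pow₀ hk
    exact ⟨by positivity, inv_le_one_of_one_le₀ this⟩
  have hc0 : Tendsto c atTop (𝓝 0) := (tendsto_pow_atTop (by norm_num)).inv_tendsto_atTop
  have hL : Tendsto (fun k => ∫ x, logReg (c k) (x - y) * lap φ x) atTop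
      (𝓝 (∫ x, Real.log ‖x - y‖ * lap φ x)) := by
    obtain ⟨M, hM⟩ := hφ.lap.hasCompactSupport.exists_bound_of_continuous
      hφ.lap.contDiff.continuous
    have hb : Integrable fun x =>
        (Metric.ball (0 : Plane) 2).indicator (fun z => (2 + ‖z‖⁻¹) * M) (x - y) :=
      (IntegrableOn.integrable_indicator
        (((integrableOn_const measure_ball_lt_top.ne).add (integrableOn_norm_inv 2)).mul_const M)
        Metric.isOpen_ball.measurableSet).comp_sub_right y
    refine tendsto_integral_filter_of_dominated_convergence _ ?_ ?_ hb ?_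
    · filter_upwards [hcpos] with k hk
      have h1 := (contDiff_logReg hk.1).continuous
      exact ((h1.comp (continuous_id.sub continuous_const)).mul
        hφ.lap.contDiff.continuous).aestronglyMeasurable
    · filter_upwards [hcpos] with k hk
      filter_upwards [Measure.ae_ne volume y] with x hx
      by_cases hxd : x ∈ disc
      · have h2 : ‖x - y‖ < 2 := (norm_sub_le _ _).trans_lt (by
          linarith [mem_disc.1 hxd, mem_disc.1 hy])
        rw [indicator_of_mem (by simpa using h2), norm_mul]
        gcongr
        · exact abs_logReg_le hk.1.le hk.2 (sub_ne_zero.2 hx) h2.le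
        · exact hM x
      · rw [hφ.lap.eq_zero_of_notMem hxd]
        simp only [mul_zero, norm_zero]
        have := (norm_nonneg _).trans (hM x)
        exact indicator_nonneg (fun z _ => by positivity) _
    · filter_upwards [Measure.ae_ne volume y] with x hx
      exact (tendsto_logReg hc0 (sub_ne_zero.2 hx)).mul_const _
  have hR : Tendsto (fun k => ∫ x, logReg (c k) (x - y) * lap φ x) atTop
      (𝓝 (2 * Real.pi * φ y)) := by
    have hpk := (tendsto_integral_comp_smul_smul_of_integrable' (μ := (volume : Measure Plane))
      (φ := peak) (fun z => by unfold peak; positivity) integral_peak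
      (by rw [finrank_plane]; exact tendsto_norm_sq_mul_peak) (g := φ) (x₀ := y)
      (hφ.contDiff.continuous.integrable_of_hasCompactSupport hφ.hasCompactSupport)
      hφ.contDiff.continuous.continuousAt).const_mul (2 * Real.pi)
    refine hpk.congr' ?_
    filter_upwards [hcpos, eventually_gt_atTop 0] with k hk hk0
    have hsm : ContDiffOn ℝ 2 (fun x => logReg (c k) (x - y)) disc :=
      (((contDiff_logReg hk.1).comp (contDiff_id.sub contDiff_const)).of_le
        ENat.LEInfty.out).contDiffOn
    rw [weakLap_lap hsm φ hφ, ← integral_const_mul]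
    congr 1 with x
    rw [lap_logReg_sub hk.1, finrank_plane, peak, norm_smul, norm_sub_rev y x,
      Real.norm_of_nonneg hk0.le, hc]
    simp only [smul_eq_mul]
    have := Real.pi_ne_zero
    field_simp
    ring
  exact tendsto_nhds_unique hL hR

/-! ### The plane and the complex numbers -/

/-- The isometry `x + i y ↦ (x, y)`. -/
noncomputable def toPlane : ℂ ≃ₗᵢ[ℝ] Plane := Complex.orthonormalBasisOneI.repr

@[simp] lemma toPlane_zero_apply (z : ℂ) : toPlane z 0 = z.re := by
  simp [toPlane, Complex.orthonormalBasisOneI_repr_apply]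

@[simp] lemma toPlane_one_apply (z : ℂ) : toPlane z 1 = z.im := by
  simp [toPlane, Complex.orthonormalBasisOneI_repr_apply]

lemma toPlane_one : toPlane 1 = EuclideanSpace.single 0 1 := by
  ext i; fin_cases i <;> simp

lemma toPlane_I : toPlane Complex.I = EuclideanSpace.single 1 1 := by
  ext i; fin_cases i <;> simp

lemma toPlane_mem_disc {z : ℂ} : toPlane z ∈ disc ↔ z ∈ Metric.ball (0 : ℂ) 1 := by
  simp [disc]

lemma laplacian_comp_toPlane {a : Plane → ℝ} {z : ℂ} (ha : ContDiffAt ℝ 2 a (toPlane z)) :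
    Laplacian.laplacian (a ∘ toPlane) z = lap a (toPlane z) := by
  have hd : DifferentiableAt ℝ (fderiv ℝ a) (toPlane z) :=
    (ha.fderiv_right (m := 1) (by norm_num)).differentiableAt (by norm_num)
  have h2 : iteratedFDeriv ℝ 2 (a ∘ toPlane) z
      = (iteratedFDeriv ℝ 2 a (toPlane z)).compContinuousLinearMap
        fun _ => (toPlane.toContinuousLinearEquiv : ℂ →L[ℝ] Plane) := by
    simp only [← iteratedFDerivWithin_univ]
    exact toPlane.toContinuousLinearEquiv.iteratedFDerivWithin_comp_right a uniqueDiffOn_univ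
      (mem_univ _) 2
  rw [InnerProductSpace.laplacian_eq_iteratedFDeriv_complexPlane]
  simp only [h2]
  simp [lap, pd_pd_eq hd, iteratedFDeriv_two_apply, Fin.sum_univ_two, toPlane_one, toPlane_I]

lemma harmonicAt_comp_toPlane {a : Plane → ℝ} {z : ℂ} (ha : ContDiffAt ℝ 2 a (toPlane z))
    (h0 : ∀ᶠ x in 𝓝 (toPlane z), lap a x = 0) :
    InnerProductSpace.HarmonicAt (a ∘ toPlane) z := by
  refine ⟨ha.comp z toPlane.contDiff.contDiffAt, ?_⟩
  have h1 : ∀ᶠ x in 𝓝 (toPlane z), ContDiffAt ℝ 2 a x := ha.eventually (by simp)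
  have h2 := (toPlane.continuous.tendsto z).eventually (h0.and h1)
  filter_upwards [h2] with w hw
  rw [laplacian_comp_toPlane hw.2, hw.1]; rfl

/-! ### The Green operator solves the Poisson equation -/

lemma regularPart_toPlane (z w : ℂ) :
    regularPart (toPlane z) (toPlane w) = Real.log ‖1 - (starRingEnd ℂ) w * z‖ := by
  have h : ‖1 - (starRingEnd ℂ) w * z‖ ^ 2
      = 1 - 2 * inner ℝ (toPlane z) (toPlane w) + ‖toPlane z‖ ^ 2 * ‖toPlane w‖ ^ 2 := by
    rw [LinearIsometryEquiv.inner_map_map, LinearIsometryEquiv.norm_map,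
      LinearIsometryEquiv.norm_map, Complex.inner, ← Complex.normSq_eq_norm_sq,
      ← Complex.normSq_eq_norm_sq, ← Complex.normSq_eq_norm_sq]
    simp [Complex.normSq_apply]
    ring
  rw [regularPart, ← h, Real.log_pow]
  push_cast; ring

lemma one_sub_conj_mul_ne_zero {z w : ℂ} (hz : ‖z‖ < 1) (hw : ‖w‖ ≤ 1) :
    1 - (starRingEnd ℂ) w * z ≠ 0 := by
  intro h
  have h1 : ‖(starRingEnd ℂ) w * z‖ = 1 := by rw [← sub_eq_zero.1 h]; simp
  rw [norm_mul, RCLike.norm_conj] at h1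
  nlinarith [norm_nonneg z, norm_nonneg w]

lemma harmonicAt_log_one_sub {z w : ℂ} (hz : ‖z‖ < 1) (hw : ‖w‖ ≤ 1) :
    InnerProductSpace.HarmonicAt (fun z => Real.log ‖1 - (starRingEnd ℂ) w * z‖) z :=
  AnalyticAt.harmonicAt_log_norm (f := fun z => 1 - (starRingEnd ℂ) w * z) (by fun_prop)
    (one_sub_conj_mul_ne_zero hz hw)

lemma regularPart_arg_pos {x y : Plane} (hx : x ∈ disc) (hy : ‖y‖ ≤ 1) :
    0 < 1 - 2 * inner ℝ x y + ‖x‖ ^ 2 * ‖y‖ ^ 2 :=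
  (pow_pos (sub_pos.2 (mem_disc.1 hx)) 2).trans_le
    (one_sub_norm_sq_le x y (mem_disc.1 hx).le hy)

lemma contDiffOn_regularPart {y : Plane} (hy : ‖y‖ ≤ 1) :
    ContDiffOn ℝ 2 (fun x => regularPart x y) disc := by
  refine contDiffOn_const.mul (ContDiffOn.log ?_ fun x hx => (regularPart_arg_pos hx hy).ne')
  exact (((contDiff_const.sub (contDiff_const.mul (contDiff_id.inner ℝ contDiff_const))).add
    ((contDiff_norm_sq ℝ).mul contDiff_const))).contDiffOn

lemma lap_regularPart {x y : Plane} (hx : x ∈ disc) (hy : y ∈ disc) :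
    lap (fun x => regularPart x y) x = 0 := by
  have hc := (contDiffOn_regularPart (mem_disc.1 hy).le).contDiffAt (disc_mem_nhds hx)
  have h1 := laplacian_comp_toPlane (z := toPlane.symm x) (a := fun x => regularPart x y)
    (by simpa using hc)
  rw [toPlane.apply_symm_apply] at h1
  rw [← h1]
  have h2 : (fun x => regularPart x y) ∘ toPlane
      = fun z => Real.log ‖1 - (starRingEnd ℂ) (toPlane.symm y) * z‖ := by
    ext z
    rw [← regularPart_toPlane]; simp
  rw [h2]
  exact (harmonicAt_log_one_sub (by simpa using mem_disc.1 hx)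
    (by simpa using (mem_disc.1 hy).le)).2.self_of_nhds

lemma integral_green_mul_lap {φ : Plane → ℝ} (hφ : IsTest φ) {y : Plane} (hy : y ∈ disc) :
    ∫ x, green x y * lap φ x = φ y := by
  have hq := contDiffOn_regularPart (mem_disc.1 hy).le
  have h1 := integral_log_mul_lap hφ hy
  have h2 := weakLap_lap hq φ hφ
  have h3 : ∀ x, lap (fun x => regularPart x y) x * φ x = 0 := by
    intro x
    by_cases hx : x ∈ disc
    · rw [lap_regularPart hx hy, zero_mul]
    · rw [hφ.eq_zero_of_notMem hx, mul_zero]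
  simp only [h3, integral_zero] at h2
  have hlog : Integrable fun x => Real.log ‖x - y‖ * lap φ x := by
    obtain ⟨M, hM⟩ := hφ.lap.hasCompactSupport.exists_bound_of_continuous
      hφ.lap.contDiff.continuous
    have hb : Integrable fun x =>
        (Metric.ball (0 : Plane) 2).indicator (fun z => (2 + ‖z‖⁻¹) * M) (x - y) :=
      (IntegrableOn.integrable_indicator
        (((integrableOn_const measure_ball_lt_top.ne).add (integrableOn_norm_inv 2)).mul_const M)
        Metric.isOpen_ball.measurableSet).comp_sub_right y
    refine hb.mono' ((by fun_prop : Measurable fun x => Real.log ‖x - y‖).aestronglyMeasurable.mul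
      hφ.lap.contDiff.continuous.aestronglyMeasurable) (ae_of_all _ fun x => ?_)
    by_cases hxd : x ∈ disc
    · have h2 : ‖x - y‖ < 2 := (norm_sub_le _ _).trans_lt (by
        linarith [mem_disc.1 hxd, mem_disc.1 hy])
      rw [indicator_of_mem (by simpa using h2), norm_mul]
      gcongr
      · exact abs_log_le (norm_nonneg _) h2.le
      · exact hM x
    · rw [hφ.lap.eq_zero_of_notMem hxd]
      simp only [mul_zero, norm_zero]
      have := (norm_nonneg _).trans (hM x)
      exact indicator_nonneg (fun z _ => by positivity) _
  have h4 : ∀ x, green x y * lap φ x = 1 / (2 * Real.pi) *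
      (Real.log ‖x - y‖ * lap φ x - regularPart x y * lap φ x) := by
    intro x; rw [green_eq]; ring
  simp only [h4]
  rw [integral_const_mul, integral_sub hlog (hφ.lap.integrable_mul hq.continuousOn), h1, h2]
  have := Real.pi_ne_zero
  field_simp
  ring

/-- The Green operator solves `Δ G(h) = h` in the sense of distributions. -/
lemma weakLap_greenOp {h : Plane → ℝ} (hi : IntegrableOn h disc) : WeakLap (greenOp h) h := by
  intro φ hφ
  have hp := integrable_green_prod hi hφ.lap.contDiff.continuous hφ.lap.hasCompactSupport
    hφ.lap.tsupport_subset
  calc ∫ x, greenOp h x * lap φ x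
      = ∫ x, ∫ y in disc, green x y * h y * lap φ x := by
        simp only [greenOp, smul_eq_mul, integral_mul_const]
    _ = ∫ y in disc, ∫ x, green x y * h y * lap φ x := integral_integral_swap hp
    _ = ∫ y in disc, h y * φ y := by
        refine setIntegral_congr_fun isOpen_disc.measurableSet fun y hy => ?_
        have : ∀ x, green x y * h y * lap φ x = h y * (green x y * lap φ x) := fun x => by ring
        simp only [this]
        rw [integral_const_mul, integral_green_mul_lap hφ hy]
    _ = ∫ y, h y * φ y := by
        refine setIntegral_eq_integral_of_forall_compl_eq_zero fun y hy => ?_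
        rw [hφ.eq_zero_of_notMem hy, mul_zero]

/-! ### Differentiability of the Green operator -/

/-- The gradient `z / (|z|² + c)` of `logReg c`, as a linear form. For `c = 0` it is the gradient
of `log |z|`, with value zero at the origin. -/
noncomputable def logKer (c : ℝ) (z : Plane) : Plane →L[ℝ] ℝ := (‖z‖ ^ 2 + c)⁻¹ • innerSL ℝ z

lemma norm_logKer {c : ℝ} (hc : 0 ≤ c) (z : Plane) : ‖logKer c z‖ = (‖z‖ ^ 2 + c)⁻¹ * ‖z‖ := by
  rw [logKer, norm_smul, innerSL_apply_norm, norm_inv, Real.norm_of_nonneg (by positivity)]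

lemma norm_logKer_le {c : ℝ} (hc : 0 ≤ c) (z : Plane) : ‖logKer c z‖ ≤ ‖z‖⁻¹ := by
  rw [norm_logKer hc]
  rcases eq_or_ne z 0 with rfl | hz
  · simp
  have hz := norm_pos_iff.2 hz
  rw [inv_mul_le_iff₀ (by positivity), le_mul_inv_iff₀ hz]
  nlinarith

lemma norm_logKer_sub {c : ℝ} (hc : 0 ≤ c) (z : Plane) :
    ‖logKer c z - logKer 0 z‖ = c * ‖z‖⁻¹ * (‖z‖ ^ 2 + c)⁻¹ := by
  rcases eq_or_ne z 0 with rfl | hz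
  · simp [logKer]
  have hz := norm_pos_iff.2 hz
  have h : (‖z‖ ^ 2 + c)⁻¹ - (‖z‖ ^ 2 + 0)⁻¹ = -(c * (‖z‖ ^ 2)⁻¹ * (‖z‖ ^ 2 + c)⁻¹) := by
    field_simp; ring
  have e : logKer c z - logKer 0 z = -(c * (‖z‖ ^ 2)⁻¹ * (‖z‖ ^ 2 + c)⁻¹) • innerSL ℝ z := by
    rw [← h]; exact (sub_smul _ _ _).symm
  rw [e, norm_smul, innerSL_apply_norm, norm_neg, Real.norm_of_nonneg (by positivity)]
  field_simp

lemma aestronglyMeasurable_logKer_sub (c : ℝ) (x : Plane) (μ : Measure Plane) :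
    AEStronglyMeasurable (fun y => logKer c (x - y)) μ := by
  have h1 : AEStronglyMeasurable (fun y => (‖x - y‖ ^ 2 + c)⁻¹) μ :=
    (by fun_prop : Measurable fun y => (‖x - y‖ ^ 2 + c)⁻¹).aestronglyMeasurable
  have h2 : AEStronglyMeasurable (fun y => innerSL ℝ (x - y)) μ :=
    (by fun_prop : Continuous fun y => innerSL ℝ (x - y)).aestronglyMeasurable
  exact h1.smul h2

section LogPotential

variable {h : Plane → ℝ}

lemma integrableOn_logKer (hc : ContinuousOn h disc) (hi : IntegrableOn h disc) {c : ℝ}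
    (hc0 : 0 ≤ c) {x : Plane} (hx : x ∈ disc) :
    IntegrableOn (fun y => h y • logKer c (x - y)) disc := by
  refine (integrableOn_norm_inv_mul hc hi hx).norm.mono'
    (hi.1.smul (aestronglyMeasurable_logKer_sub c x _)) (ae_of_all _ fun y => ?_)
  rw [norm_smul, norm_mul, mul_comm, norm_inv, norm_norm]
  gcongr
  exact norm_logKer_le hc0 _

lemma ae_abs_logReg_mul_le {c : ℝ} (hc0 : 0 ≤ c) (hc1 : c ≤ 1) {x : Plane} (hx : x ∈ disc) :
    ∀ᵐ y ∂volume.restrict disc,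
      ‖logReg c (x - y) * h y‖ ≤ 2 * ‖h y‖ + ‖‖x - y‖⁻¹ * h y‖ := by
  filter_upwards [ae_restrict_mem isOpen_disc.measurableSet,
    ae_restrict_of_ae (Measure.ae_ne volume x)] with y hy hyx
  have h2 : ‖x - y‖ ≤ 2 := (norm_sub_le _ _).trans (by linarith [mem_disc.1 hx, mem_disc.1 hy])
  rw [norm_mul, norm_mul, norm_inv, norm_norm, ← add_mul]
  gcongr
  exact abs_logReg_le hc0 hc1 (sub_ne_zero.2 hyx.symm) h2

lemma measurable_logReg_sub (c : ℝ) (x : Plane) : Measurable fun y => logReg c (x - y) := by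
  unfold logReg; fun_prop

lemma integrableOn_logReg_mul (hc : ContinuousOn h disc) (hi : IntegrableOn h disc) {c : ℝ}
    (hc0 : 0 ≤ c) (hc1 : c ≤ 1) {x : Plane} (hx : x ∈ disc) :
    IntegrableOn (fun y => logReg c (x - y) * h y) disc :=
  ((hi.norm.const_mul 2).add (integrableOn_norm_inv_mul hc hi hx).norm).mono'
    ((measurable_logReg_sub c x).aestronglyMeasurable.mul hi.1) (ae_abs_logReg_mul_le hc0 hc1 hx)

lemma hasFDerivAt_integral_logReg (hc : ContinuousOn h disc) (hi : IntegrableOn h disc) {c : ℝ}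
    (hc0 : 0 < c) (hc1 : c ≤ 1) {x : Plane} (hx : x ∈ disc) :
    HasFDerivAt (fun x => ∫ y in disc, logReg c (x - y) * h y)
      (∫ y in disc, h y • logKer c (x - y)) x := by
  refine hasFDerivAt_integral_of_dominated_of_fderiv_le (𝕜 := ℝ)
    (F' := fun x y => h y • logKer c (x - y)) (bound := fun y => c⁻¹ * 2 * ‖h y‖)
    (disc_mem_nhds hx)
    (Eventually.of_forall fun x => (measurable_logReg_sub c x).aestronglyMeasurable.mul hi.1)
    (integrableOn_logReg_mul hc hi hc0.le hc1 hx)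
    (hi.1.smul (aestronglyMeasurable_logKer_sub c x _)) ?_ (hi.norm.const_mul _) ?_
  · filter_upwards [ae_restrict_mem isOpen_disc.measurableSet] with y hy x hx
    have h2 : ‖x - y‖ ≤ 2 := (norm_sub_le _ _).trans (by linarith [mem_disc.1 hx, mem_disc.1 hy])
    rw [norm_smul, norm_logKer hc0.le, mul_comm]
    gcongr
    nlinarith [sq_nonneg ‖x - y‖]
  · filter_upwards with y x _
    exact (hasFDerivAt_logReg_sub hc0 x y).mul_const (h y)

/-- The logarithmic potential of `h` is differentiable: the gradients of the regularised
potentials converge uniformly near every point of the disc. -/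
lemma hasFDerivAt_integral_log (hc : ContinuousOn h disc) (hi : IntegrableOn h disc)
    {x₀ : Plane} (hx₀ : x₀ ∈ disc) :
    HasFDerivAt (fun x => ∫ y in disc, Real.log ‖x - y‖ * h y)
      (∫ y in disc, h y • logKer 0 (x₀ - y)) x₀ := by
  obtain ⟨R, hR, hRd⟩ := Metric.nhds_basis_closedBall.mem_iff.1 (disc_mem_nhds hx₀)
  obtain ⟨M, hM⟩ := (isCompact_closedBall x₀ R).exists_bound_of_continuousOn (hc.mono hRd)
  have hM0 : 0 ≤ M := (norm_nonneg _).trans (hM x₀ (Metric.mem_closedBall_self hR.le))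
  set ρ := R / 2 with hρ
  have hρ0 : 0 < ρ := by positivity
  set c : ℕ → ℝ := fun n => 1 / ((n : ℝ) + 1) with hcdef
  have hc0 : ∀ n, 0 < c n := fun n => by positivity
  have hc1 : ∀ n, c n ≤ 1 := fun n => by
    rw [hcdef]; simp only; rw [div_le_one (by positivity)]; linarith [n.cast_nonneg (α := ℝ)]
  have hclim : Tendsto c atTop (𝓝 0) := tendsto_one_div_add_atTop_nhds_zero_nat
  have hball : ∀ x ∈ Metric.ball x₀ ρ, x ∈ disc := fun x hx =>
    hRd (Metric.ball_subset_closedBall (Metric.ball_subset_ball (by linarith) hx))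
  -- Within distance `ρ` of `x` the function `h` is bounded by `M` and the error of the regularised
  -- gradient kernel tends to zero in `L¹`; farther away that error is uniformly `O(c)`.
  set κ : ℝ → Plane → ℝ := fun c z => ‖logKer c z - logKer 0 z‖ with hκ
  have hκle : ∀ {c}, 0 ≤ c → ∀ z, κ c z ≤ ‖z‖⁻¹ := by
    intro c hc z
    rw [hκ]; simp only
    rw [norm_logKer_sub hc, mul_comm c, mul_assoc]
    refine mul_le_of_le_one_right (by positivity) ?_
    rw [← div_eq_mul_inv]
    exact div_le_one_of_le₀ (by nlinarith [sq_nonneg ‖z‖]) (by positivity)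
  have hκm : ∀ c, AEStronglyMeasurable (κ c) volume := by
    intro c
    have := ((aestronglyMeasurable_logKer_sub c 0 volume).sub
      (aestronglyMeasurable_logKer_sub 0 0 volume)).norm
    have h2 := this.comp_quasiMeasurePreserving
      (Measure.measurePreserving_neg volume).quasiMeasurePreserving
    simpa [Function.comp_def, hκ] using h2
  have hI : Tendsto (fun n => ∫ z in Metric.ball 0 ρ, κ (c n) z) atTop (𝓝 0) := by
    have := tendsto_integral_of_dominated_convergence (μ := volume.restrict (Metric.ball 0 ρ))
      (F := fun n => κ (c n)) (f := fun _ => (0 : ℝ)) (fun z => ‖z‖⁻¹)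
      (fun n => (hκm _).restrict) (integrableOn_norm_inv ρ)
      (fun n => ae_of_all _ fun z => by
        rw [Real.norm_of_nonneg (norm_nonneg _)]; exact hκle (hc0 n).le z)
      (ae_of_all _ fun z => by
        simp only [hκ]
        rcases eq_or_ne z 0 with rfl | hz
        · simp [logKer]
        have hz := norm_pos_iff.2 hz
        have e : ∀ n, ‖logKer (c n) z - logKer 0 z‖ = c n * ‖z‖⁻¹ * (‖z‖ ^ 2 + c n)⁻¹ :=
          fun n => norm_logKer_sub (hc0 n).le z
        simp only [e]
        have h1 := (hclim.mul_const ‖z‖⁻¹).mul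
          ((tendsto_const_nhds (x := ‖z‖ ^ 2)).add hclim |>.inv₀ (by positivity))
        simpa using h1)
    simpa using this
  set b : ℕ → ℝ := fun n => M * (∫ z in Metric.ball 0 ρ, κ (c n) z)
    + c n * (ρ⁻¹ * (ρ ^ 2)⁻¹) * ∫ y in disc, ‖h y‖ with hb
  have hblim : Tendsto b atTop (𝓝 0) := by
    have := (hI.const_mul M).add
      ((hclim.mul_const (ρ⁻¹ * (ρ ^ 2)⁻¹)).mul_const (∫ y in disc, ‖h y‖))
    rwa [mul_zero, zero_mul, zero_mul, add_zero] at this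
  have hbound : ∀ n, ∀ x ∈ Metric.ball x₀ ρ,
      ‖(∫ y in disc, h y • logKer 0 (x - y)) - ∫ y in disc, h y • logKer (c n) (x - y)‖ ≤ b n := by
    intro n x hx
    have hxd := hball x hx
    have hk : Integrable (fun y => (Metric.ball (0 : Plane) ρ).indicator (κ (c n)) (x - y)) :=
      (IntegrableOn.integrable_indicator ((integrableOn_norm_inv ρ).mono' (hκm _).restrict
        (ae_of_all _ fun z => by
          rw [Real.norm_of_nonneg (norm_nonneg _)]; exact hκle (hc0 n).le z))
        Metric.isOpen_ball.measurableSet).comp_sub_left x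
    have hk0 : ∀ y, 0 ≤ (Metric.ball (0 : Plane) ρ).indicator (κ (c n)) (x - y) := fun y =>
      indicator_nonneg (fun z _ => norm_nonneg _) _
    rw [← integral_sub (integrableOn_logKer hc hi le_rfl hxd)
      (integrableOn_logKer hc hi (hc0 n).le hxd)]
    have hint : IntegrableOn (fun y => M * (Metric.ball (0 : Plane) ρ).indicator (κ (c n)) (x - y)
        + c n * (ρ⁻¹ * (ρ ^ 2)⁻¹) * ‖h y‖) disc :=
      (hk.integrableOn.const_mul M).add (hi.norm.const_mul _)
    refine (norm_integral_le_of_norm_le hint (ae_of_all _ fun y => ?_)).trans ?_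
    · have e : h y • logKer 0 (x - y) - h y • logKer (c n) (x - y)
          = h y • (logKer 0 (x - y) - logKer (c n) (x - y)) := (smul_sub _ _ _).symm
      rw [e, norm_smul, norm_sub_rev]
      by_cases hy : ‖x - y‖ < ρ
      · have h1 : ‖h y‖ ≤ M := by
          refine hM y ?_
          rw [mem_closedBall_iff_norm]
          have h3 : ‖y - x₀‖ ≤ ‖x - y‖ + ‖x - x₀‖ := by
            have := norm_sub_le (x - x₀) (x - y)
            rw [sub_sub_sub_cancel_left] at this
            linarith
          have h4 := mem_ball_iff_norm.1 hx
          linarith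
        rw [indicator_of_mem (by simpa using hy)]
        have h5 : 0 ≤ c n * (ρ⁻¹ * (ρ ^ 2)⁻¹) * ‖h y‖ := by have := hc0 n; positivity
        have h6 : ‖h y‖ * ‖logKer (c n) (x - y) - logKer 0 (x - y)‖ ≤ M * κ (c n) (x - y) := by
          gcongr
        linarith
      · push Not at hy
        have h5 : ‖logKer (c n) (x - y) - logKer 0 (x - y)‖ ≤ c n * (ρ⁻¹ * (ρ ^ 2)⁻¹) := by
          rw [norm_logKer_sub (hc0 n).le, mul_assoc]
          have := hc0 n
          gcongr
          nlinarith
        have h6 := mul_nonneg hM0 (hk0 y)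
        have h7 := mul_le_mul_of_nonneg_left h5 (norm_nonneg (h y))
        linarith
    · rw [integral_add (hk.integrableOn.const_mul M) (hi.norm.const_mul _), integral_const_mul,
        integral_const_mul, hb]
      have h8 : ∫ y in disc, (Metric.ball (0 : Plane) ρ).indicator (κ (c n)) (x - y)
          ≤ ∫ z in Metric.ball 0 ρ, κ (c n) z := by
        rw [← integral_indicator Metric.isOpen_ball.measurableSet,
          ← integral_sub_left_eq_self _ volume x]
        exact setIntegral_le_integral hk (ae_of_all _ hk0)
      simp only
      gcongr
  refine hasFDerivAt_of_tendstoUniformlyOn (l := atTop) (s := Metric.ball x₀ ρ)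
    (f := fun n x => ∫ y in disc, logReg (c n) (x - y) * h y)
    (f' := fun n x => ∫ y in disc, h y • logKer (c n) (x - y))
    (g' := fun x => ∫ y in disc, h y • logKer 0 (x - y)) Metric.isOpen_ball ?_
    (fun n x hx => hasFDerivAt_integral_logReg hc hi (hc0 n) (hc1 n) (hball x hx)) ?_
    (Metric.mem_ball_self hρ0)
  · rw [Metric.tendstoUniformlyOn_iff]
    intro ε hε
    filter_upwards [hblim.eventually_lt_const hε] with n hn x hx
    rw [dist_eq_norm]
    exact (hbound n x hx).trans_lt hn
  · intro x hx
    refine tendsto_integral_of_dominated_convergence _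
      (fun n => (measurable_logReg_sub (c n) x).aestronglyMeasurable.mul hi.1)
      ((hi.norm.const_mul 2).add (integrableOn_norm_inv_mul hc hi (hball x hx)).norm)
      (fun n => ae_abs_logReg_mul_le (hc0 n).le (hc1 n) (hball x hx)) ?_
    filter_upwards [ae_restrict_of_ae (Measure.ae_ne volume x)] with y hy
    exact (tendsto_logReg hclim (sub_ne_zero.2 hy.symm)).mul_const _

lemma hasFDerivAt_regularPart {x y : Plane} (hx : x ∈ disc) (hy : ‖y‖ ≤ 1) :
    HasFDerivAt (fun x => regularPart x y)
      ((1 - 2 * inner ℝ x y + ‖x‖ ^ 2 * ‖y‖ ^ 2)⁻¹ •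
        (‖y‖ ^ 2 • innerSL ℝ x - innerSL ℝ y)) x := by
  have h1 : HasFDerivAt (fun x : Plane => ‖x‖ ^ 2) (2 • innerSL ℝ x) x := by
    simpa using (hasFDerivAt_id x).norm_sq
  have h2 : HasFDerivAt (fun x : Plane => inner ℝ x y) (innerSL ℝ y) x := by
    simp_rw [real_inner_comm y]
    exact (innerSL ℝ y).hasFDerivAt
  have h3 := ((h2.const_mul 2).const_sub 1).add (h1.mul_const (‖y‖ ^ 2))
  have h4 := (h3.log (regularPart_arg_pos hx hy).ne').const_mul (1 / 2)
  refine h4.congr_fderiv ?_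
  ext v
  simp
  ring

lemma differentiableAt_integral_regularPart (hi : IntegrableOn h disc) {x₀ : Plane}
    (hx₀ : x₀ ∈ disc) :
    DifferentiableAt ℝ (fun x => ∫ y in disc, regularPart x y * h y) x₀ := by
  obtain ⟨r, hr0, hr1⟩ := exists_between (mem_disc.1 hx₀)
  have hmeas : ∀ x, Measurable fun y => regularPart x y := by
    intro x; unfold regularPart; fun_prop
  refine (hasFDerivAt_integral_of_dominated_of_fderiv_le (𝕜 := ℝ) (s := Metric.ball 0 r)
    (F' := fun x y => h y • ((1 - 2 * inner ℝ x y + ‖x‖ ^ 2 * ‖y‖ ^ 2)⁻¹ •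
        (‖y‖ ^ 2 • innerSL ℝ x - innerSL ℝ y)))
    (bound := fun y => ‖h y‖ * (((1 - r) ^ 2)⁻¹ * 2))
    (Metric.isOpen_ball.mem_nhds (by simpa using hr0))
    (Eventually.of_forall fun x => (hmeas x).aestronglyMeasurable.mul hi.1)
    ?_ ?_ ?_ (hi.norm.mul_const _) ?_).differentiableAt
  · refine (hi.norm.const_mul (2 + |Real.log (1 - ‖x₀‖)|)).mono'
      ((hmeas x₀).aestronglyMeasurable.mul hi.1) ?_
    filter_upwards [ae_restrict_mem isOpen_disc.measurableSet] with y hy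
    rw [Pi.mul_apply, norm_mul]
    gcongr
    exact abs_regularPart_le (mem_disc.1 hx₀) le_rfl (mem_disc.1 hy).le
  · have h1 : AEStronglyMeasurable (fun y => (1 - 2 * inner ℝ x₀ y + ‖x₀‖ ^ 2 * ‖y‖ ^ 2)⁻¹)
        (volume.restrict disc) :=
      (by fun_prop : Measurable fun y =>
        (1 - 2 * inner ℝ x₀ y + ‖x₀‖ ^ 2 * ‖y‖ ^ 2)⁻¹).aestronglyMeasurable
    have h2 : AEStronglyMeasurable (fun y : Plane => ‖y‖ ^ 2 • innerSL ℝ x₀ - innerSL ℝ y)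
        (volume.restrict disc) :=
      (by fun_prop : Continuous fun y : Plane =>
        ‖y‖ ^ 2 • innerSL ℝ x₀ - innerSL ℝ y).aestronglyMeasurable
    exact hi.1.smul (h1.smul h2)
  · filter_upwards [ae_restrict_mem isOpen_disc.measurableSet] with y hy x hx
    have hx' : ‖x‖ < r := by simpa using hx
    have hy' := mem_disc.1 hy
    have hxd : x ∈ disc := mem_disc.2 (hx'.trans hr1)
    rw [norm_smul, norm_smul, norm_inv, Real.norm_of_nonneg (regularPart_arg_pos hxd hy'.le).le]
    have h1 := one_sub_norm_sq_le x y (hx'.trans hr1).le hy'.le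
    have h2 : (1 - r) ^ 2 ≤ (1 - ‖x‖) ^ 2 := by gcongr
    have h3 : 0 < (1 - r) ^ 2 := pow_pos (by linarith) 2
    have h4 : ‖‖y‖ ^ 2 • innerSL ℝ x - innerSL ℝ y‖ ≤ 2 := by
      refine (norm_sub_le _ _).trans ?_
      rw [norm_smul, innerSL_apply_norm, innerSL_apply_norm, norm_pow, norm_norm]
      have : ‖y‖ ^ 2 * ‖x‖ ≤ 1 * 1 := by
        gcongr
        · exact pow_le_one₀ (norm_nonneg _) hy'.le
        · linarith
      linarith
    gcongr
    exact h2.trans h1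
  · filter_upwards [ae_restrict_mem isOpen_disc.measurableSet] with y hy x hx
    have hxd : x ∈ disc := mem_disc.2 (lt_trans (by simpa using hx) hr1)
    exact (hasFDerivAt_regularPart hxd (mem_disc.1 hy).le).mul_const (h y)

/-- The Green operator maps integrable continuous functions to differentiable ones. -/
lemma differentiableAt_greenOp (hc : ContinuousOn h disc) (hi : IntegrableOn h disc) {x : Plane}
    (hx : x ∈ disc) : DifferentiableAt ℝ (greenOp h) x := by
  have h1 := ((hasFDerivAt_integral_log hc hi hx).differentiableAt.sub
    (differentiableAt_integral_regularPart hi hx)).const_mul (1 / (2 * Real.pi))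
  refine h1.congr_of_eventuallyEq ?_
  filter_upwards [disc_mem_nhds hx] with z hz
  have hlog : IntegrableOn (fun y => Real.log ‖z - y‖ * h y) disc := by
    simpa only [logReg_zero] using integrableOn_logReg_mul hc hi le_rfl zero_le_one hz
  have hreg : IntegrableOn (fun y => regularPart z y * h y) disc := by
    have h2 := hlog.sub ((integrableOn_green_mul hc hi hz).const_mul (2 * Real.pi))
    refine h2.congr (ae_of_all _ fun y => ?_)
    have := Real.pi_ne_zero
    simp only [green_eq, Pi.sub_apply]
    field_simp
    ring
  simp only [greenOp, smul_eq_mul, Pi.sub_apply]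
  rw [← integral_sub hlog hreg, ← integral_const_mul]
  congr 1 with y
  rw [green_eq]; ring

end LogPotential

open Real
open scoped Convolution

/-! ### Poisson integrals and Weyl's lemma -/

/-- The Poisson integral over the circle of radius `r` is bounded by the mean of the modulus. -/
lemma abs_circleAverage_poisson_le {d : ℂ → ℝ} {r : ℝ} {w : ℂ}
    (hw : w ∈ Metric.ball (0 : ℂ) r) (hd : ContinuousOn d (Metric.sphere 0 r)) :
    |circleAverage ((Complex.re ∘ herglotzRieszKernel 0 w) • d) 0 r|
      ≤ (r + ‖w‖) / (r - ‖w‖) * circleAverage (fun z => |d z|) 0 r := by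
  have hr : 0 < r := Metric.pos_of_mem_ball hw
  have hw' : ‖w‖ < r := by simpa using hw
  have hP : ContinuousOn (Complex.re ∘ herglotzRieszKernel 0 w) (Metric.sphere 0 r) := by
    have := continuousOn_herglotzRieszKernel_sphere hw
    rw [abs_of_pos hr] at this
    exact Complex.continuous_re.comp_continuousOn this
  refine abs_circleAverage_le_circleAverage_abs.trans ?_
  rw [← smul_eq_mul, ← circleAverage_fun_smul]
  refine circleAverage_mono ((hP.smul hd).abs.circleIntegrable hr.le)
    ((hd.abs.const_smul ((r + ‖w‖) / (r - ‖w‖))).circleIntegrable hr.le) fun z hz => ?_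
  rw [abs_of_pos hr] at hz
  have h1 := re_herglotzRieszKernel_le hz hw
  have h2 := le_re_herglotzRieszKernel hz hw
  simp only [sub_zero] at h1 h2
  change |((z - 0 + (w - 0)) / (z - 0 - (w - 0))).re * d z| ≤ (r + ‖w‖) / (r - ‖w‖) * |d z|
  simp only [sub_zero]
  rw [abs_mul, abs_of_nonneg (le_trans (div_nonneg (by linarith) (by positivity)) h2)]
  gcongr

/-- Uniform limits of harmonic functions are harmonic: the Poisson formula survives the limit, and
the Herglotz integral exhibits the limit as the real part of a holomorphic function. -/
lemma harmonicOnNhd_ball_of_approx {a : ℂ → ℝ} {r : ℝ}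
    (ha : ContinuousOn a (Metric.closedBall 0 r))
    (happ : ∀ ε > 0, ∃ b : ℂ → ℝ, InnerProductSpace.HarmonicOnNhd b (Metric.closedBall 0 r) ∧
      ∀ z ∈ Metric.closedBall (0 : ℂ) r, |a z - b z| ≤ ε) :
    InnerProductSpace.HarmonicOnNhd a (Metric.ball 0 r) := by
  have hpoisson : ∀ w ∈ Metric.ball (0 : ℂ) r,
      a w = circleAverage ((Complex.re ∘ herglotzRieszKernel 0 w) • a) 0 r := by
    intro w hw
    have hr : 0 < r := Metric.pos_of_mem_ball hw
    have hw' : ‖w‖ < r := by simpa using hw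
    set K := (r + ‖w‖) / (r - ‖w‖) with hK
    have hK0 : 0 ≤ K := div_nonneg (by positivity) (by linarith)
    have hP : ContinuousOn (Complex.re ∘ herglotzRieszKernel 0 w) (Metric.sphere 0 r) := by
      have := continuousOn_herglotzRieszKernel_sphere hw
      rw [abs_of_pos hr] at this
      exact Complex.continuous_re.comp_continuousOn this
    have has := ha.mono Metric.sphere_subset_closedBall
    have key : ∀ ε > 0, |a w - circleAverage ((Complex.re ∘ herglotzRieszKernel 0 w) • a) 0 r|
        ≤ ε * (1 + K) := by
      intro ε hε
      obtain ⟨b, hb, hab⟩ := happ ε hε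
      have hbs : ContinuousOn b (Metric.sphere 0 r) :=
        hb.continuousOn.mono Metric.sphere_subset_closedBall
      have h1 := hb.circleAverage_re_herglotzRieszKernel_smul hw
      have h2 := abs_circleAverage_poisson_le hw (has.sub hbs)
      have h3 : circleAverage ((Complex.re ∘ herglotzRieszKernel 0 w) • (a - b)) 0 r
          = circleAverage ((Complex.re ∘ herglotzRieszKernel 0 w) • a) 0 r - b w := by
        rw [smul_sub, circleAverage_sub ((hP.smul has).circleIntegrable hr.le)
          ((hP.smul hbs).circleIntegrable hr.le), h1]
      have h4 : circleAverage (fun z => |(a - b) z|) 0 r ≤ ε := by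
        refine circleAverage_mono_on_of_le_circle ((has.sub hbs).abs.circleIntegrable hr.le)
          fun z hz => ?_
        rw [abs_of_pos hr] at hz
        exact hab z (Metric.sphere_subset_closedBall hz)
      have h5 := hab w (Metric.ball_subset_closedBall hw)
      change |circleAverage ((Complex.re ∘ herglotzRieszKernel 0 w) • (a - b)) 0 r|
        ≤ K * circleAverage (fun z => |(a - b) z|) 0 r at h2
      rw [h3] at h2
      have h6 : K * circleAverage (fun z => |(a - b) z|) 0 r ≤ K * ε := by gcongr
      calc |a w - circleAverage ((Complex.re ∘ herglotzRieszKernel 0 w) • a) 0 r|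
          = |(a w - b w) - (circleAverage ((Complex.re ∘ herglotzRieszKernel 0 w) • a) 0 r - b w)|
            := by ring_nf
        _ ≤ |a w - b w| +
            |circleAverage ((Complex.re ∘ herglotzRieszKernel 0 w) • a) 0 r - b w| := abs_sub _ _
        _ ≤ ε * (1 + K) := by linarith
    refine sub_eq_zero.1 (abs_eq_zero.1 (le_antisymm (le_of_forall_pos_le_add fun δ hδ => ?_)
      (abs_nonneg _)))
    have := key (δ / (1 + K)) (by positivity)
    rw [div_mul_cancel₀ _ (by positivity)] at this
    linarith
  intro w hw
  have hr : 0 < r := Metric.pos_of_mem_ball hw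
  have hci : CircleIntegrable a 0 r :=
    (ha.mono Metric.sphere_subset_closedBall).circleIntegrable hr.le
  have hci' : CircleIntegrable (fun z => (a z : ℂ)) 0 r :=
    (Complex.continuous_ofReal.comp_continuousOn
      (ha.mono Metric.sphere_subset_closedBall)).circleIntegrable hr.le
  have han := analyticOnNhd_circleAverage_herglotzRieszKernel_smul hci' w hw
  refine (InnerProductSpace.harmonicAt_congr_nhds ?_).1 han.harmonicAt_re
  filter_upwards [Metric.isOpen_ball.mem_nhds hw] with z hz
  rw [hpoisson z hz]
  exact re_circleAverage_herglotzRieszKernel_smul hci hz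

lemma pd_comp_const_sub {ρ : Plane → ℝ} (hρ : Differentiable ℝ ρ) (i : Fin 2) (x : Plane) :
    pd i (fun t => ρ (x - t)) = fun t => -pd i ρ (x - t) := by
  ext t
  have h : HasFDerivAt (fun t => ρ (x - t)) _ t :=
    HasFDerivAt.comp (f := fun t => x - t) t hρ.differentiableAt.hasFDerivAt
      ((hasFDerivAt_id t).const_sub x)
  rw [pd, h.fderiv]
  simp [pd]

lemma lap_comp_const_sub {ρ : Plane → ℝ} (hρ : ContDiff ℝ ∞ ρ) (x t : Plane) :
    lap (fun t => ρ (x - t)) t = lap ρ (x - t) := by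
  have h1 : ∀ i, Differentiable ℝ (pd i ρ) := fun i => (contDiff_pd hρ).differentiable (by simp)
  have h2 : ∀ i, pd i (pd i fun t => ρ (x - t)) t = pd i (pd i ρ) (x - t) := by
    intro i
    rw [pd_comp_const_sub (hρ.differentiable (by simp))]
    have h3 := pd_const_mul (i := i) (a := fun t => pd i ρ (x - t)) (x := t) (-1)
      ((h1 i).comp (differentiable_const x |>.sub differentiable_id)).differentiableAt
    simp only [neg_one_mul] at h3
    rw [h3, pd_comp_const_sub (h1 i), neg_neg]
  simp only [lap, h2]

/-- Differentiation of a mollification falls on the mollifier. -/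
lemma pd_convolution {a ρ : Plane → ℝ} (ha : LocallyIntegrable a) (hρ : ContDiff ℝ ∞ ρ)
    (hc : HasCompactSupport ρ) (i : Fin 2) :
    pd i (a ⋆[ContinuousLinearMap.lsmul ℝ ℝ] ρ)
      = a ⋆[ContinuousLinearMap.lsmul ℝ ℝ] (pd i ρ) := by
  ext x
  have hρ1 : ContDiff ℝ 1 ρ := hρ.of_le ENat.LEInfty.out
  rw [pd, (hc.hasFDerivAt_convolution_right _ ha hρ1 x).fderiv,
    convolution_precompR_apply _ ha (hc.fderiv ℝ) (hρ1.continuous_fderiv (by simp))]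
  rfl

lemma lap_convolution {a ρ : Plane → ℝ} (ha : LocallyIntegrable a) (hρ : ContDiff ℝ ∞ ρ)
    (hc : HasCompactSupport ρ) (x : Plane) :
    lap (a ⋆[ContinuousLinearMap.lsmul ℝ ℝ] ρ) x = ∫ t, a t * lap ρ (x - t) := by
  have hc1 : ∀ i, HasCompactSupport (pd i ρ) := fun i =>
    hc.of_isClosed_subset (isClosed_tsupport _) (tsupport_pd_subset i ρ)
  have hc2 : ∀ i, HasCompactSupport (pd i (pd i ρ)) := fun i =>
    (hc1 i).of_isClosed_subset (isClosed_tsupport _) (tsupport_pd_subset i _)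
  have hs2 : ∀ i, Continuous (pd i (pd i ρ)) := fun i => (contDiff_pd (contDiff_pd hρ)).continuous
  simp only [lap, pd_convolution ha hρ hc, pd_convolution ha (contDiff_pd hρ) (hc1 _),
    Finset.mul_sum]
  have hint : ∀ i, Integrable fun t => a t * pd i (pd i ρ) (x - t) := fun i =>
    ((hc2 i).convolutionExists_right (ContinuousLinearMap.lsmul ℝ ℝ) ha (hs2 i) x).integrable
  rw [integral_finsetSum _ fun i _ => hint i]
  rfl

/-- Weyl's lemma: continuous distributional solutions of the Laplace equation are harmonic. -/
lemma WeakLap.harmonicOnNhd {a : Plane → ℝ} (hc : ContinuousOn a disc)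
    (hw : WeakLap a fun _ => 0) :
    InnerProductSpace.HarmonicOnNhd (a ∘ toPlane) (Metric.ball 0 1) := by
  intro z₀ hz₀
  obtain ⟨r, hr0, hr1⟩ := exists_between (show ‖z₀‖ < 1 by simpa using hz₀)
  obtain ⟨R, hrR, hR1⟩ := exists_between hr1
  have hRd : Metric.closedBall (0 : Plane) R ⊆ disc := fun x hx =>
    mem_disc.2 ((by simpa using hx : ‖x‖ ≤ R).trans_lt hR1)
  have haR : ContinuousOn a (Metric.closedBall 0 R) := hc.mono hRd
  have hball : ∀ z ∈ Metric.closedBall (0 : ℂ) r, toPlane z ∈ Metric.closedBall (0 : Plane) R :=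
    fun z hz => by
      have : ‖z‖ ≤ r := by simpa using hz
      simpa using this.trans hrR.le
  refine harmonicOnNhd_ball_of_approx (r := r)
    (haR.comp toPlane.continuous.continuousOn hball) (fun ε hε => ?_) z₀ (by simpa using hr0)
  -- Mollifying `a`, cut off to a disc of radius `R < 1`, gives functions that converge to `a`
  -- uniformly for `|z| ≤ r` and are harmonic there, the translated mollifiers being test functions.
  set A := (Metric.closedBall (0 : Plane) R).indicator a with hA
  have hAint : Integrable A :=
    (haR.integrableOn_compact (isCompact_closedBall _ _)).integrable_indicator
      Metric.isClosed_closedBall.measurableSet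
  obtain ⟨δ, hδ, hunif⟩ := Metric.uniformContinuousOn_iff.1
    ((isCompact_closedBall (0 : Plane) R).uniformContinuousOn_of_continuous haR) ε hε
  set η := min δ ((R - r) / 2) with hη
  have hη0 : 0 < η := lt_min hδ (by linarith)
  have hηR : η ≤ (R - r) / 2 := min_le_right _ _
  let B : ContDiffBump (0 : Plane) := ⟨η / 2, η, by positivity, by linarith⟩
  set ρ := B.normed (volume : Measure Plane) with hρ
  have hρs : ContDiff ℝ ∞ ρ := B.contDiff_normed
  have hρc : HasCompactSupport ρ := B.hasCompactSupport_normed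
  have hρt : tsupport ρ = Metric.closedBall 0 η := B.tsupport_normed_eq
  have hsm : ContDiff ℝ 2 (A ⋆[ContinuousLinearMap.lsmul ℝ ℝ] ρ) :=
    (hρc.contDiff_convolution_right (n := ⊤) (ContinuousLinearMap.lsmul ℝ ℝ)
      hAint.locallyIntegrable hρs).of_le ENat.LEInfty.out
  have hlap : ∀ x : Plane, ‖x‖ < R - η → lap (A ⋆[ContinuousLinearMap.lsmul ℝ ℝ] ρ) x = 0 := by
    intro x hx
    have hsub : tsupport (fun t => ρ (x - t)) ⊆ Metric.ball 0 R := by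
      have h1 : tsupport (fun t => ρ (x - t)) ⊆ Metric.closedBall x η := by
        refine closure_minimal (fun t ht => ?_) Metric.isClosed_closedBall
        have := subset_tsupport ρ (show x - t ∈ Function.support ρ from ht)
        rw [hρt, mem_closedBall_zero_iff, norm_sub_rev] at this
        rwa [mem_closedBall_iff_norm]
      refine h1.trans fun t ht => ?_
      rw [mem_closedBall_iff_norm] at ht
      rw [mem_ball_zero_iff]
      have := norm_add_le (t - x) x
      rw [sub_add_cancel] at this
      linarith
    have htest : IsTest fun t => ρ (x - t) :=
      ⟨hρs.comp (contDiff_const.sub contDiff_id),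
        (isCompact_closedBall (0 : Plane) R).of_isClosed_subset (isClosed_tsupport _)
          (hsub.trans Metric.ball_subset_closedBall),
        hsub.trans (Metric.ball_subset_closedBall.trans hRd)⟩
    rw [lap_convolution hAint.locallyIntegrable hρs hρc]
    have h0 := hw _ htest
    simp only [zero_mul, integral_zero] at h0
    rw [← h0]
    congr 1 with t
    rw [lap_comp_const_sub hρs]
    by_cases ht : t ∈ Metric.closedBall (0 : Plane) R
    · rw [hA, indicator_of_mem ht]
    · have h2 : t ∉ tsupport (fun t => ρ (x - t)) := fun h =>
        ht (Metric.ball_subset_closedBall (hsub h))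
      have h3 : lap (fun t => ρ (x - t)) t = 0 := by
        have h4 : ∀ i, pd i (pd i fun t => ρ (x - t)) t = 0 := fun i =>
          image_eq_zero_of_notMem_tsupport fun h =>
            h2 (tsupport_pd_subset _ _ (tsupport_pd_subset _ _ h))
        simp [lap, h4]
      rw [lap_comp_const_sub hρs] at h3
      rw [h3, mul_zero, mul_zero]
  refine ⟨(A ⋆[ContinuousLinearMap.lsmul ℝ ℝ] ρ) ∘ toPlane, fun z hz => ?_, fun z hz => ?_⟩
  · have hz' : ‖toPlane z‖ ≤ r := by simpa using hz
    refine harmonicAt_comp_toPlane hsm.contDiffAt ?_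
    have hlt : ‖toPlane z‖ < R - η := by linarith
    filter_upwards [(isOpen_lt continuous_norm continuous_const).mem_nhds hlt] with x hx
    exact hlap x hx
  · have hz' : ‖toPlane z‖ ≤ r := by simpa using hz
    have hzR := hball z hz
    have hconv : (A ⋆[ContinuousLinearMap.lsmul ℝ ℝ] ρ) (toPlane z)
        = (ρ ⋆[ContinuousLinearMap.lsmul ℝ ℝ] A) (toPlane z) := by
      rw [convolution_lsmul, convolution_lsmul_swap]
      simp only [smul_eq_mul, mul_comm]
    have hAz : A (toPlane z) = a (toPlane z) := indicator_of_mem hzR _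
    have h1 := B.dist_normed_convolution_le (μ := (volume : Measure Plane)) (g := A)
      (x₀ := toPlane z) (ε := ε) hAint.aestronglyMeasurable (fun x hx => by
        have hx' : ‖x - toPlane z‖ < η := mem_ball_iff_norm.1 hx
        have hxR : x ∈ Metric.closedBall (0 : Plane) R := by
          rw [mem_closedBall_zero_iff]
          have := norm_add_le (x - toPlane z) (toPlane z)
          rw [sub_add_cancel] at this
          linarith
        rw [hAz, hA, indicator_of_mem hxR]
        refine (hunif x hxR _ hzR ?_).le
        rw [dist_eq_norm]
        exact hx'.trans_le (min_le_left _ _))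
    rw [hAz, dist_comm, Real.dist_eq] at h1
    simpa [hconv] using h1

/-! ### Boundary behaviour of the Green operator -/

lemma green_nonpos {x y : Plane} (hx : x ∈ disc) (hy : y ∈ disc) (hxy : x ≠ y) :
    green x y ≤ 0 := by
  rw [green_eq]
  refine mul_nonpos_of_nonneg_of_nonpos (by positivity) (sub_nonpos.2 ?_)
  have h0 : 0 < ‖x - y‖ := norm_pos_iff.2 (sub_ne_zero.2 hxy)
  have h1 : ‖x - y‖ ^ 2 ≤ 1 - 2 * inner ℝ x y + ‖x‖ ^ 2 * ‖y‖ ^ 2 := by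
    rw [norm_sub_sq_real]
    have h2 : ‖x‖ ^ 2 ≤ 1 := pow_le_one₀ (norm_nonneg _) (mem_disc.1 hx).le
    have h3 : ‖y‖ ^ 2 ≤ 1 := pow_le_one₀ (norm_nonneg _) (mem_disc.1 hy).le
    nlinarith
  have h4 := Real.log_le_log (by positivity) h1
  rw [Real.log_pow] at h4
  push_cast at h4
  rw [regularPart]
  linarith

lemma toPlane_circleMap_mem_disc {r : ℝ} (hr0 : 0 < r) (hr1 : r < 1) (θ : ℝ) :
    toPlane (circleMap 0 r θ) ∈ disc := by
  rw [mem_disc, LinearIsometryEquiv.norm_map, norm_circleMap_zero, abs_of_pos hr0]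
  exact hr1

lemma continuousOn_green_sphere {r : ℝ} (hr1 : r < 1) {y : Plane} (hy : y ∈ disc)
    (hyr : ‖y‖ ≠ r) :
    ContinuousOn (fun z : ℂ => Real.log ‖z - toPlane.symm y‖) (Metric.sphere 0 r) ∧
    ContinuousOn (fun z : ℂ => regularPart (toPlane z) y) (Metric.sphere 0 r) := by
  constructor
  · refine ContinuousOn.log (by fun_prop) fun z hz => ?_
    rw [norm_ne_zero_iff, sub_ne_zero]
    rintro rfl
    exact hyr (by simpa using hz)
  · refine (contDiffOn_regularPart (mem_disc.1 hy).le).continuousOn.comp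
      toPlane.continuous.continuousOn fun z hz => ?_
    have : ‖z‖ = r := by simpa using hz
    rw [mem_disc, LinearIsometryEquiv.norm_map, this]
    exact hr1

/-- A lower bound for the mean of the Green function over a circle about the origin: the regular part
is harmonic and contributes its value `0` at the centre, and the mean of `log |z - y|` is
`max (log r) (log |y|)`. -/
lemma le_circleAverage_green {r : ℝ} (hr0 : 0 < r) (hr1 : r < 1) {y : Plane} (hy : y ∈ disc)
    (hyr : ‖y‖ ≠ r) :
    1 / (2 * π) * Real.log r ≤ circleAverage (fun z => green (toPlane z) y) 0 r := by
  obtain ⟨h1, h2⟩ := continuousOn_green_sphere hr1 hy hyr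
  have hfun : (fun z => green (toPlane z) y) = fun z => (1 / (2 * π)) •
      (Real.log ‖z - toPlane.symm y‖ - regularPart (toPlane z) y) := by
    ext z
    rw [green_eq, smul_eq_mul]
    congr 3
    rw [← LinearIsometryEquiv.norm_map toPlane (z - _), map_sub,
      LinearIsometryEquiv.apply_symm_apply]
  have havg : circleAverage (fun z => regularPart (toPlane z) y) 0 r = 0 := by
    have h3 : (fun z => regularPart (toPlane z) y)
        = fun z => Real.log ‖1 - (starRingEnd ℂ) (toPlane.symm y) * z‖ := by
      ext z
      rw [← regularPart_toPlane, LinearIsometryEquiv.apply_symm_apply]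
    have h4 : InnerProductSpace.HarmonicOnNhd
        (fun z => Real.log ‖1 - (starRingEnd ℂ) (toPlane.symm y) * z‖)
        (Metric.closedBall 0 |r|) := by
      intro z hz
      rw [abs_of_pos hr0] at hz
      refine harmonicAt_log_one_sub ((by simpa using hz : ‖z‖ ≤ r).trans_lt hr1) ?_
      simpa using (mem_disc.1 hy).le
    rw [h3, h4.circleAverage_eq]
    simp
  have hlog := circleAverage_log_norm_sub_const_eq_log_radius_add_posLog (c := 0)
    (a := toPlane.symm y) hr0.ne'
  rw [hfun, circleAverage_fun_smul, circleAverage_fun_sub (h1.circleIntegrable hr0.le)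
    (h2.circleIntegrable hr0.le), havg, hlog, smul_eq_mul]
  have := posLog_nonneg (x := r⁻¹ * ‖0 - toPlane.symm y‖)
  gcongr
  linarith

lemma lintegral_green_circle_le {r : ℝ} (hr0 : 0 < r) (hr1 : r < 1) {y : Plane} (hy : y ∈ disc)
    (hyr : ‖y‖ ≠ r) :
    ∫⁻ θ in Ioc 0 (2 * π), ‖green (toPlane (circleMap 0 r θ)) y‖ₑ
      ≤ ENNReal.ofReal (-Real.log r) := by
  obtain ⟨h1, h2⟩ := continuousOn_green_sphere hr1 hy hyr
  have hcont : ContinuousOn (fun z => green (toPlane z) y) (Metric.sphere 0 r) := by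
    refine ((h1.sub h2).const_smul (1 / (2 * π))).congr fun z hz => ?_
    simp only [Pi.smul_apply, Pi.sub_apply]
    rw [green_eq, smul_eq_mul]
    congr 3
    rw [← LinearIsometryEquiv.norm_map toPlane (z - _), map_sub,
      LinearIsometryEquiv.apply_symm_apply]
  have hci : IntegrableOn (fun θ => green (toPlane (circleMap 0 r θ)) y) (Ioc 0 (2 * π)) :=
    (intervalIntegrable_iff_integrableOn_Ioc_of_le two_pi_pos.le).1
      (hcont.circleIntegrable hr0.le)
  -- The Green function has a sign, so the integral of its modulus is governed by its mean.
  have hneg : ∀ θ, green (toPlane (circleMap 0 r θ)) y ≤ 0 := fun θ =>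
    green_nonpos (toPlane_circleMap_mem_disc hr0 hr1 θ) hy fun h => hyr (by
      rw [← h, LinearIsometryEquiv.norm_map, norm_circleMap_zero, abs_of_pos hr0])
  have h3 := le_circleAverage_green hr0 hr1 hy hyr
  rw [circleAverage_def, intervalIntegral.integral_of_le two_pi_pos.le, smul_eq_mul, one_div] at h3
  have h4 := le_of_mul_le_mul_left h3 (by positivity)
  rw [← ofReal_integral_norm_eq_lintegral_enorm hci]
  refine ENNReal.ofReal_le_ofReal ?_
  simp only [Real.norm_eq_abs, abs_of_nonpos (hneg _)]
  rw [integral_neg]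
  linarith

/-- The mean of `|G(h)|` over the circle of radius `r` is at most `(1 / 2π) |log r| ‖h‖₁`. -/
lemma circleAverage_abs_greenOp_le {h : Plane → ℝ} (hc : ContinuousOn h disc)
    (hi : IntegrableOn h disc) {r : ℝ} (hr0 : 0 < r) (hr1 : r < 1) :
    circleAverage (fun z => |greenOp h (toPlane z)|) 0 r
      ≤ (2 * π)⁻¹ * (-Real.log r * ∫ y in disc, ‖h y‖) := by
  have hlog : 0 ≤ -Real.log r := neg_nonneg.2 (Real.log_nonpos hr0.le hr1.le)
  have hGc : Continuous fun θ => greenOp h (toPlane (circleMap 0 r θ)) := by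
    refine continuous_iff_continuousAt.2 fun θ => ?_
    exact ContinuousAt.comp (f := fun θ => toPlane (circleMap 0 r θ))
      (differentiableAt_greenOp hc hi (toPlane_circleMap_mem_disc hr0 hr1 θ)).continuousAt
      (toPlane.continuous.comp (continuous_circleMap 0 r)).continuousAt
  have hmeas : AEMeasurable (fun p : ℝ × Plane =>
      ‖green (toPlane (circleMap 0 r p.1)) p.2‖ₑ * ‖h p.2‖ₑ)
      ((volume.restrict (Ioc 0 (2 * π))).prod (volume.restrict disc)) := by
    have h0 : Measurable fun θ => toPlane (circleMap 0 r θ) :=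
      (toPlane.continuous.comp (continuous_circleMap 0 r)).measurable
    have hp : Measurable fun p : ℝ × Plane => (toPlane (circleMap 0 r p.1), p.2) :=
      (h0.comp measurable_fst).prodMk measurable_snd
    have h1 : Measurable fun p : ℝ × Plane => green (toPlane (circleMap 0 r p.1)) p.2 :=
      (measurable_green.comp hp :)
    exact h1.enorm.aemeasurable.mul hi.1.comp_snd.enorm
  have key : ∫⁻ θ in Ioc 0 (2 * π), ‖greenOp h (toPlane (circleMap 0 r θ))‖ₑ
      ≤ ENNReal.ofReal (-Real.log r * ∫ y in disc, ‖h y‖) := by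
    calc ∫⁻ θ in Ioc 0 (2 * π), ‖greenOp h (toPlane (circleMap 0 r θ))‖ₑ
        ≤ ∫⁻ θ in Ioc 0 (2 * π), ∫⁻ y in disc,
            ‖green (toPlane (circleMap 0 r θ)) y‖ₑ * ‖h y‖ₑ := by
          refine lintegral_mono fun θ => (enorm_integral_le_lintegral_enorm _).trans_eq ?_
          simp only [smul_eq_mul, enorm_mul]
      _ = ∫⁻ y in disc, ∫⁻ θ in Ioc 0 (2 * π),
            ‖green (toPlane (circleMap 0 r θ)) y‖ₑ * ‖h y‖ₑ := lintegral_lintegral_swap hmeas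
      _ ≤ ∫⁻ y in disc, ENNReal.ofReal (-Real.log r) * ‖h y‖ₑ := by
          refine lintegral_mono_ae ?_
          have hne : ∀ᵐ y : Plane, ‖y‖ ≠ r := by
            have h0 : (volume : Measure Plane) (Metric.sphere 0 r) = 0 :=
              Measure.addHaar_sphere_of_ne_zero _ _ hr0.ne'
            filter_upwards [measure_eq_zero_iff_ae_notMem.1 h0] with y hy
            simpa using hy
          filter_upwards [ae_restrict_mem isOpen_disc.measurableSet, ae_restrict_of_ae hne]
            with y hy hyr
          rw [lintegral_mul_const']
          · gcongr
            exact lintegral_green_circle_le hr0 hr1 hy hyr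
          · exact enorm_ne_top
      _ = ENNReal.ofReal (-Real.log r * ∫ y in disc, ‖h y‖) := by
          rw [lintegral_const_mul' _ _ ENNReal.ofReal_ne_top,
            ← ofReal_integral_norm_eq_lintegral_enorm hi, ← ENNReal.ofReal_mul hlog]
  have hint : IntegrableOn (fun θ => greenOp h (toPlane (circleMap 0 r θ))) (Ioc 0 (2 * π)) :=
    (intervalIntegrable_iff_integrableOn_Ioc_of_le two_pi_pos.le).1 (hGc.intervalIntegrable _ _)
  rw [← ofReal_integral_norm_eq_lintegral_enorm hint] at key
  have hnn : 0 ≤ -Real.log r * ∫ y in disc, ‖h y‖ :=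
    mul_nonneg hlog (integral_nonneg fun y => norm_nonneg _)
  rw [ENNReal.ofReal_le_ofReal_iff hnn] at key
  rw [circleAverage_def, intervalIntegral.integral_of_le two_pi_pos.le, smul_eq_mul]
  gcongr
  simpa only [Real.norm_eq_abs] using key

/-- `G(h)` vanishes on the unit circle in the mean. -/
lemma tendsto_circleAverage_abs_greenOp {h : Plane → ℝ} (hc : ContinuousOn h disc)
    (hi : IntegrableOn h disc) :
    Tendsto (fun r => circleAverage (fun z => |greenOp h (toPlane z)|) 0 r) (𝓝[<] 1) (𝓝 0) := by
  have hlim : Tendsto (fun r : ℝ => (2 * π)⁻¹ * (-Real.log r * ∫ y in disc, ‖h y‖)) (𝓝[<] 1)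
      (𝓝 0) := by
    have h1 : Tendsto Real.log (𝓝[<] 1) (𝓝 0) := by
      have := (Real.continuousAt_log one_ne_zero).tendsto
      rw [Real.log_one] at this
      exact this.mono_left nhdsWithin_le_nhds
    simpa using (h1.neg.mul_const (∫ y in disc, ‖h y‖)).const_mul (2 * π)⁻¹
  refine tendsto_of_tendsto_of_tendsto_of_le_of_le' tendsto_const_nhds hlim
    (Eventually.of_forall fun r => circleAverage_nonneg_of_nonneg fun z _ => abs_nonneg _) ?_
  filter_upwards [Ioo_mem_nhdsLT (zero_lt_one' ℝ)] with r hr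
  exact circleAverage_abs_greenOp_le hc hi hr.1 hr.2

/-! ### Harmonic functions with boundary values `x H` -/

/-- Harmonic functions that vanish in the mean on the circles of radius `r → 1` tend to zero at
every point. The function may depend on the circle. -/
lemma tendsto_zero_of_circleAverage {K : ℝ → ℂ → ℝ}
    (hK : ∀ r, InnerProductSpace.HarmonicOnNhd (K r) (Metric.ball 0 1))
    (hlim : Tendsto (fun r => circleAverage (fun z => |K r z|) 0 r) (𝓝[<] 1) (𝓝 0))
    {w : ℂ} (hw : w ∈ Metric.ball (0 : ℂ) 1) : Tendsto (fun r => K r w) (𝓝[<] 1) (𝓝 0) := by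
  have hw' : ‖w‖ < 1 := by simpa using hw
  have hfac : Tendsto (fun r : ℝ => (r + ‖w‖) / (r - ‖w‖)) (𝓝[<] 1)
      (𝓝 ((1 + ‖w‖) / (1 - ‖w‖))) := by
    have hid : Tendsto (fun r : ℝ => r) (𝓝[<] 1) (𝓝 1) := nhdsWithin_le_nhds
    exact (hid.add_const _).div (hid.sub_const _) (by linarith)
  have hb := hfac.mul hlim
  rw [mul_zero] at hb
  refine squeeze_zero_norm' ?_ hb
  filter_upwards [Ioo_mem_nhdsLT hw'] with r hr
  have hwr : w ∈ Metric.ball (0 : ℂ) r := by simpa using hr.1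
  have hKr : InnerProductSpace.HarmonicOnNhd (K r) (Metric.closedBall 0 r) :=
    (hK r).mono (Metric.closedBall_subset_ball hr.2)
  rw [← hKr.circleAverage_re_herglotzRieszKernel_smul hwr]
  exact abs_circleAverage_poisson_le hwr
    (hKr.continuousOn.mono Metric.sphere_subset_closedBall)

/-- Let `H` be harmonic in the disc and let the harmonic functions `E₁`, `E₂` have the boundary
values `c x₁ H`, `c x₂ H` in the mean. Then `div (E₁, E₂) = c (H + x · ∇H + H(0))`.

Writing `H = Re φ` with `φ(z) = φ(0) + z q(z)` and `ψ(z) = z φ(z) + conj(φ(0)) z`, one has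
`2 z H = ψ + r² conj q` on the circle `|z| = r`. Hence `E₁ = (c / 2) Re (ψ + q)` and
`E₂ = (c / 2) Im (ψ - q)`, and in the divergence the terms with `q` cancel. -/
lemma fderiv_add_fderiv_of_boundary {H E₁ E₂ : ℂ → ℝ} {c : ℝ}
    (hH : InnerProductSpace.HarmonicOnNhd H (Metric.ball 0 1))
    (hE₁ : InnerProductSpace.HarmonicOnNhd E₁ (Metric.ball 0 1))
    (hE₂ : InnerProductSpace.HarmonicOnNhd E₂ (Metric.ball 0 1))
    (h₁ : Tendsto (fun r => circleAverage (fun z => |E₁ z - c * (z.re * H z)|) 0 r) (𝓝[<] 1) (𝓝 0))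
    (h₂ : Tendsto (fun r => circleAverage (fun z => |E₂ z - c * (z.im * H z)|) 0 r) (𝓝[<] 1) (𝓝 0))
    {w : ℂ} (hw : w ∈ Metric.ball (0 : ℂ) 1) :
    fderiv ℝ E₁ w 1 + fderiv ℝ E₂ w Complex.I = c * (H w + fderiv ℝ H w w + H 0) := by
  obtain ⟨φ, hφ, hφH⟩ := hH.exists_analyticOnNhd_ball_re_eq
  have h0 : (0 : ℂ) ∈ Metric.ball (0 : ℂ) 1 := by simp
  have hqd : DifferentiableOn ℂ (dslope φ 0) (Metric.ball 0 1) :=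
    (Complex.differentiableOn_dslope (Metric.isOpen_ball.mem_nhds h0)).2 hφ.differentiableOn
  set q := dslope φ 0 with hqdef
  have hq : AnalyticOnNhd ℂ q (Metric.ball 0 1) := hqd.analyticOnNhd Metric.isOpen_ball
  have hφq : ∀ z, φ z = φ 0 + z * q z := by
    intro z
    have := sub_smul_dslope φ 0 z
    rw [sub_zero, smul_eq_mul] at this
    rw [hqdef, this]; ring
  set ψ : ℂ → ℂ := fun z => z * φ z + (starRingEnd ℂ) (φ 0) * z with hψdef
  have hψ : AnalyticOnNhd ℂ ψ (Metric.ball 0 1) := fun z hz =>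
    (analyticAt_id.mul (hφ z hz)).add (analyticAt_const.mul analyticAt_id)
  have hid : Tendsto (fun r : ℝ => r) (𝓝[<] 1) (𝓝 1) := nhdsWithin_le_nhds
  have hr2 : Tendsto (fun r : ℝ => ((r ^ 2 : ℝ) : ℂ)) (𝓝[<] 1) (𝓝 1) := by
    have h := (Complex.continuous_ofReal.tendsto (1 ^ 2)).comp (hid.pow 2)
    simpa [Function.comp_def] using h
  have hE₁eq : ∀ z ∈ Metric.ball (0 : ℂ) 1, E₁ z = c / 2 * (ψ z + q z).re := by
    intro z hz
    have hlim := tendsto_zero_of_circleAverage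
      (K := fun r z => E₁ z - (c / 2) • (ψ z + ((r ^ 2 : ℝ) : ℂ) * q z).re)
      (fun r z hz => (hE₁ z hz).sub
        (((hψ z hz).add (analyticAt_const.mul (hq z hz))).harmonicAt_re.const_smul)) ?_ hz
    · have hlim2 : Tendsto (fun r : ℝ => E₁ z - (c / 2) • (ψ z + ((r ^ 2 : ℝ) : ℂ) * q z).re)
          (𝓝[<] 1) (𝓝 (E₁ z - (c / 2) • (ψ z + 1 * q z).re)) :=
        tendsto_const_nhds.sub (((Complex.continuous_re.tendsto _).comp
          (tendsto_const_nhds.add (hr2.mul_const _))).const_smul _)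
      have := tendsto_nhds_unique hlim hlim2
      rw [one_mul, smul_eq_mul] at this
      linarith
    · refine h₁.congr' ?_
      filter_upwards [Ioo_mem_nhdsLT (zero_lt_one' ℝ)] with r hr
      refine circleAverage_congr_sphere fun z hz => ?_
      have hzr : ‖z‖ = r := by simpa [abs_of_pos hr.1] using hz
      have hz1 : z ∈ Metric.ball (0 : ℂ) 1 := by simpa [hzr] using hr.2
      have e : z.re * H z = 1 / 2 * (ψ z + ((r ^ 2 : ℝ) : ℂ) * q z).re := by
        have e1 : (r ^ 2 : ℝ) = z.re * z.re + z.im * z.im := by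
          rw [← hzr, ← Complex.normSq_eq_norm_sq, Complex.normSq_apply]
        rw [← hφH hz1]
        simp only [hψdef]
        rw [hφq z, e1]
        simp
        ring
      simp only [e, smul_eq_mul]
      congr 1; ring
  have hE₂eq : ∀ z ∈ Metric.ball (0 : ℂ) 1, E₂ z = c / 2 * (ψ z - q z).im := by
    intro z hz
    have hlim := tendsto_zero_of_circleAverage
      (K := fun r z => E₂ z - (c / 2) • (ψ z - ((r ^ 2 : ℝ) : ℂ) * q z).im)
      (fun r z hz => (hE₂ z hz).sub
        (((hψ z hz).sub (analyticAt_const.mul (hq z hz))).harmonicAt_im.const_smul)) ?_ hz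
    · have hlim2 : Tendsto (fun r : ℝ => E₂ z - (c / 2) • (ψ z - ((r ^ 2 : ℝ) : ℂ) * q z).im)
          (𝓝[<] 1) (𝓝 (E₂ z - (c / 2) • (ψ z - 1 * q z).im)) :=
        tendsto_const_nhds.sub (((Complex.continuous_im.tendsto _).comp
          (tendsto_const_nhds.sub (hr2.mul_const _))).const_smul _)
      have := tendsto_nhds_unique hlim hlim2
      rw [one_mul, smul_eq_mul] at this
      linarith
    · refine h₂.congr' ?_
      filter_upwards [Ioo_mem_nhdsLT (zero_lt_one' ℝ)] with r hr
      refine circleAverage_congr_sphere fun z hz => ?_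
      have hzr : ‖z‖ = r := by simpa [abs_of_pos hr.1] using hz
      have hz1 : z ∈ Metric.ball (0 : ℂ) 1 := by simpa [hzr] using hr.2
      have e : z.im * H z = 1 / 2 * (ψ z - ((r ^ 2 : ℝ) : ℂ) * q z).im := by
        have e1 : (r ^ 2 : ℝ) = z.re * z.re + z.im * z.im := by
          rw [← hzr, ← Complex.normSq_eq_norm_sq, Complex.normSq_apply]
        rw [← hφH hz1]
        simp only [hψdef]
        rw [hφq z, e1]
        simp
        ring
      simp only [e, smul_eq_mul]
      congr 1; ring
  have hnhds : Metric.ball (0 : ℂ) 1 ∈ 𝓝 w := Metric.isOpen_ball.mem_nhds hw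
  have dφ : HasDerivAt φ (deriv φ w) w := (hφ w hw).differentiableAt.hasDerivAt
  have dq : HasDerivAt q (deriv q w) w := (hq w hw).differentiableAt.hasDerivAt
  have dψ : HasDerivAt ψ (1 * φ w + w * deriv φ w + (starRingEnd ℂ) (φ 0) * 1) w :=
    ((hasDerivAt_id w).mul dφ).add ((hasDerivAt_id w).const_mul _)
  have fH : HasFDerivAt H (Complex.reCLM.comp (deriv φ w • (1 : ℂ →L[ℝ] ℂ))) w :=
    (Complex.reCLM.hasFDerivAt.comp w dφ.complexToReal_fderiv).congr_of_eventuallyEq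
      (mem_of_superset hnhds fun z hz => (hφH hz).symm)
  have fE₁ : HasFDerivAt E₁ ((c / 2) • Complex.reCLM.comp
      ((1 * φ w + w * deriv φ w + (starRingEnd ℂ) (φ 0) * 1 + deriv q w) • (1 : ℂ →L[ℝ] ℂ))) w :=
    ((Complex.reCLM.hasFDerivAt.comp w (dψ.add dq).complexToReal_fderiv).const_mul
      (c / 2)).congr_of_eventuallyEq (mem_of_superset hnhds fun z hz => hE₁eq z hz)
  have fE₂ : HasFDerivAt E₂ ((c / 2) • Complex.imCLM.comp
      ((1 * φ w + w * deriv φ w + (starRingEnd ℂ) (φ 0) * 1 - deriv q w) • (1 : ℂ →L[ℝ] ℂ))) w :=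
    ((Complex.imCLM.hasFDerivAt.comp w (dψ.sub dq).complexToReal_fderiv).const_mul
      (c / 2)).congr_of_eventuallyEq (mem_of_superset hnhds fun z hz => hE₂eq z hz)
  rw [fE₁.fderiv, fE₂.fderiv, fH.fderiv, ← hφH hw, ← hφH h0]
  simp
  ring

/-! ### Vector fields and their components -/

lemma gradient_apply (a : Plane → ℝ) (x : Plane) (j : Fin 2) : gradient a x j = pd j a x := by
  have h : inner ℝ (gradient a x) (EuclideanSpace.single j (1 : ℝ)) = pd j a x := by
    simp [gradient, pd]
  rw [← h, EuclideanSpace.inner_single_right]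
  simp

lemma fderiv_self_eq_inner (a : Plane → ℝ) (x : Plane) :
    fderiv ℝ a x x = inner ℝ x (gradient a x) := by
  rw [real_inner_comm]
  simp [gradient]

lemma fderiv_self_eq_sum (a : Plane → ℝ) (x : Plane) :
    fderiv ℝ a x x = x 0 * pd 0 a x + x 1 * pd 1 a x := by
  rw [fderiv_self_eq_inner, PiLp.inner_apply]
  simp [Fin.sum_univ_two, gradient_apply, mul_comm]

lemma divergence_eq {v : Plane → Plane} {x : Plane} (hv : DifferentiableAt ℝ v x) :
    divergence v x = pd 0 (fun y => v y 0) x + pd 1 (fun y => v y 1) x := by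
  have h : ∀ i : Fin 2, fderiv ℝ v x (EuclideanSpace.single i 1) i = pd i (fun y => v y i) x := by
    intro i
    have h1 : HasFDerivAt (fun y => v y i)
        ((EuclideanSpace.proj i : Plane →L[ℝ] ℝ).comp (fderiv ℝ v x)) x :=
      (EuclideanSpace.proj i : Plane →L[ℝ] ℝ).hasFDerivAt.comp x hv.hasFDerivAt
    rw [pd, h1.fderiv]; rfl
  simp only [divergence, h, Fin.sum_univ_two]

lemma laplacian_apply {u : Plane → Plane} {x : Plane} (hu : ContDiffAt ℝ 2 u x) (j : Fin 2) :
    Laplacian.laplacian u x j = lap (fun y => u y j) x := by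
  have h1 := hu.laplacian_CLM_comp_left (l := (EuclideanSpace.proj j : Plane →L[ℝ] ℝ))
  have hc : ContDiffAt ℝ 2 (fun y => u y j) x :=
    (EuclideanSpace.proj j : Plane →L[ℝ] ℝ).contDiff.contDiffAt.comp x hu
  have hd : DifferentiableAt ℝ (fderiv ℝ (fun y => u y j)) x :=
    (hc.fderiv_right (m := 1) (by norm_num)).differentiableAt (by norm_num)
  have h2 : Laplacian.laplacian (fun y => u y j) x = lap (fun y => u y j) x := by
    rw [InnerProductSpace.laplacian_eq_iteratedFDeriv_orthonormalBasis _
      (EuclideanSpace.basisFun (Fin 2) ℝ)]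
    simp [lap, pd_pd_eq hd, iteratedFDeriv_two_apply]
  rw [← h2]
  exact h1.symm

section GreenVector

variable {v : Plane → Plane}

lemma contDiffOn_coord {n : WithTop ℕ∞} (hv : ContDiffOn ℝ n v disc) (j : Fin 2) :
    ContDiffOn ℝ n (fun y => v y j) disc :=
  (EuclideanSpace.proj j : Plane →L[ℝ] ℝ).contDiff.comp_contDiffOn hv

lemma continuousOn_coord {s : Set Plane} (hv : ContinuousOn v s) (j : Fin 2) :
    ContinuousOn (fun y => v y j) s :=
  (EuclideanSpace.proj j : Plane →L[ℝ] ℝ).continuous.comp_continuousOn hv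

lemma integrableOn_coord (hv : IntegrableOn v disc) (j : Fin 2) :
    IntegrableOn (fun y => v y j) disc :=
  (EuclideanSpace.proj j : Plane →L[ℝ] ℝ).integrable_comp hv

lemma integrableOn_green_smul (hc : ContinuousOn v disc) (hi : IntegrableOn v disc) {x : Plane}
    (hx : x ∈ disc) : IntegrableOn (fun y => green x y • v y) disc := by
  have hm : AEStronglyMeasurable (fun y => green x y) (volume.restrict disc) :=
    (measurable_green.comp (measurable_const.prodMk measurable_id)).aestronglyMeasurable
  refine Integrable.mono (integrableOn_green_mul hc.norm hi.norm hx) (hm.smul hi.1)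
    (ae_of_all _ fun y => ?_)
  simp [norm_smul]

lemma greenOp_apply (hc : ContinuousOn v disc) (hi : IntegrableOn v disc) {x : Plane}
    (hx : x ∈ disc) (j : Fin 2) : greenOp v x j = greenOp (fun y => v y j) x :=
  ((EuclideanSpace.proj j : Plane →L[ℝ] ℝ).integral_comp_comm
    (integrableOn_green_smul hc hi hx)).symm

lemma greenOp_apply_eventuallyEq (hc : ContinuousOn v disc) (hi : IntegrableOn v disc) {x : Plane}
    (hx : x ∈ disc) (j : Fin 2) :
    (fun z => greenOp v z j) =ᶠ[𝓝 x] greenOp (fun y => v y j) :=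
  mem_of_superset (disc_mem_nhds hx) fun _ hz => greenOp_apply hc hi hz j

lemma greenRegularAt (hc : ContinuousOn v disc) (hi : IntegrableOn v disc) {x : Plane}
    (hx : x ∈ disc) : GreenRegularAt v x := by
  refine ⟨integrableOn_green_smul hc hi hx, differentiableAt_euclidean.2 fun j => ?_⟩
  exact (differentiableAt_greenOp (continuousOn_coord hc j) (integrableOn_coord hi j)
    hx).congr_of_eventuallyEq (greenOp_apply_eventuallyEq hc hi hx j)

lemma divergence_greenOp (hc : ContinuousOn v disc) (hi : IntegrableOn v disc) {x : Plane}
    (hx : x ∈ disc) : divergence (greenOp v) x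
      = pd 0 (greenOp fun y => v y 0) x + pd 1 (greenOp fun y => v y 1) x := by
  rw [divergence_eq (greenRegularAt hc hi hx).2, pd_congr (greenOp_apply_eventuallyEq hc hi hx 0),
    pd_congr (greenOp_apply_eventuallyEq hc hi hx 1)]

end GreenVector

lemma continuousOn_greenOp {h : Plane → ℝ} (hc : ContinuousOn h disc) (hi : IntegrableOn h disc) :
    ContinuousOn (greenOp h) disc := fun _ hx =>
  (differentiableAt_greenOp hc hi hx).continuousAt.continuousWithinAt

/-! ### The equation for the effective viscous flux -/

lemma lap_pd_comm {φ : Plane → ℝ} (hφ : IsTest φ) (i : Fin 2) :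
    lap (pd i φ) = pd i (lap φ) := by
  ext x
  have h : ∀ j, pd j (pd j (pd i φ)) = pd i (pd j (pd j φ)) := fun j => by
    rw [hφ.pd_comm j i, (hφ.pd j).pd_comm j i]
  have h2 : pd i (lap φ) x = pd i (pd 0 (pd 0 φ)) x + pd i (pd 1 (pd 1 φ)) x := by
    rw [← pd_add ((hφ.pd 0).pd 0).differentiable.differentiableAt
      ((hφ.pd 1).pd 1).differentiable.differentiableAt]
    refine pd_congr (Eventually.of_forall fun y => ?_)
    simp [lap, Fin.sum_univ_two]
  rw [h2]
  simp [lap, Fin.sum_univ_two, h]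

/-- `∇ div u - Δ u` is divergence free in the sense of distributions. -/
lemma sum_integral_pd_div_mul_pd {u : Fin 2 → Plane → ℝ} (hu : ∀ i, ContDiffOn ℝ 2 (u i) disc)
    {φ : Plane → ℝ} (hφ : IsTest φ) :
    ∑ i, ∫ x, pd i (fun y => ∑ j, pd j (u j) y) x * pd i φ x
      = ∑ i, ∫ x, lap (u i) x * pd i φ x := by
  have h1 : ∀ j, ContDiffOn ℝ 1 (pd j (u j)) disc := fun j => contDiffOn_pd (hu j) (by norm_num)
  have hd : ContDiffOn ℝ 1 (fun y => ∑ j, pd j (u j) y) disc := ContDiffOn.sum fun j _ => h1 j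
  have e1 : ∀ i, ∫ x, pd i (fun y => ∑ j, pd j (u j) y) x * pd i φ x
      = -∫ x, (∑ j, pd j (u j) x) * pd i (pd i φ) x := fun i => by
    rw [(hφ.pd i).integral_mul_pd hd, neg_neg]
  have e2 : ∑ i, ∫ x, (∑ j, pd j (u j) x) * pd i (pd i φ) x
      = ∑ j, ∫ x, pd j (u j) x * lap φ x := by
    rw [← integral_mul_lap hφ hd.continuousOn]
    simp only [Finset.sum_mul]
    exact integral_finsetSum _ fun j _ => hφ.lap.integrable_mul (h1 j).continuousOn
  have e3 : ∀ j, ∫ x, pd j (u j) x * lap φ x = -∫ x, lap (u j) x * pd j φ x := fun j => by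
    rw [← weakLap_lap (hu j) _ (hφ.pd j), lap_pd_comm hφ,
      hφ.lap.integral_mul_pd ((hu j).of_le (by norm_num)), neg_neg]
  simp only [e1, Finset.sum_neg_distrib, e2, e3, neg_neg]

/-- Taking the divergence of `∇F = μ (∇ div u - Δ u) + f` gives `Δ F = div f`. -/
lemma weakLap_of_gradient_eq {u f : Fin 2 → Plane → ℝ} {F : Plane → ℝ} {μ : ℝ}
    (hu : ∀ i, ContDiffOn ℝ 2 (u i) disc) (hf : ∀ i, ContDiffOn ℝ 1 (f i) disc)
    (hF : ContDiffOn ℝ 1 F disc)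
    (heq : ∀ i, ∀ x ∈ disc, pd i F x
      = μ * (pd i (fun y => ∑ j, pd j (u j) y) x - lap (u i) x) + f i x) :
    WeakLap F fun x => ∑ i, pd i (f i) x := by
  intro φ hφ
  have h1 : ∀ j, ContDiffOn ℝ 1 (pd j (u j)) disc := fun j => contDiffOn_pd (hu j) (by norm_num)
  have hd : ContDiffOn ℝ 1 (fun y => ∑ j, pd j (u j) y) disc := ContDiffOn.sum fun j _ => h1 j
  have hdc : ∀ i, ContinuousOn (pd i fun y => ∑ j, pd j (u j) y) disc := fun i =>
    (contDiffOn_pd (m := 0) hd (by norm_num)).continuousOn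
  have hlc : ∀ i, ContinuousOn (lap (u i)) disc := fun i => by
    have : ∀ j, ContinuousOn (pd j (pd j (u i))) disc := fun j =>
      (contDiffOn_pd (m := 0) (contDiffOn_pd (m := 1) (hu i) (by norm_num))
        (by norm_num)).continuousOn
    exact continuousOn_finsetSum _ fun j _ => this j
  have hfc : ∀ i, ContinuousOn (pd i (f i)) disc := fun i =>
    (contDiffOn_pd (m := 0) (hf i) (by norm_num)).continuousOn
  have e1 : ∀ i, ∫ x, F x * pd i (pd i φ) x
      = -(μ * ((∫ x, pd i (fun y => ∑ j, pd j (u j) y) x * pd i φ x)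
        - ∫ x, lap (u i) x * pd i φ x)) + ∫ x, pd i (f i) x * φ x := by
    intro i
    have i1 := (hφ.pd i).integrable_mul (hdc i)
    have i2 := (hφ.pd i).integrable_mul (hlc i)
    have i3 := (hφ.pd i).integrable_mul (hf i).continuousOn
    have e : ∀ x, pd i F x * pd i φ x = μ * (pd i (fun y => ∑ j, pd j (u j) y) x * pd i φ x
        - lap (u i) x * pd i φ x) + f i x * pd i φ x := by
      intro x
      by_cases hx : x ∈ disc
      · rw [heq i x hx]; ring
      · rw [(hφ.pd i).eq_zero_of_notMem hx]; ring
    have i4 : Integrable fun x => μ * (pd i (fun y => ∑ j, pd j (u j) y) x * pd i φ x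
        - lap (u i) x * pd i φ x) := (i1.sub i2).const_mul μ
    rw [(hφ.pd i).integral_mul_pd hF]
    simp only [e]
    rw [integral_add i4 i3, integral_const_mul, integral_sub i1 i2,
      hφ.integral_mul_pd (hf i)]
    ring
  rw [integral_mul_lap hφ hF.continuousOn]
  simp only [e1, Finset.sum_mul]
  rw [integral_finsetSum _ fun i _ => hφ.integrable_mul (hfc i), Finset.sum_add_distrib,
    Finset.sum_neg_distrib, ← Finset.mul_sum, Finset.sum_sub_distrib,
    sum_integral_pd_div_mul_pd hu hφ]
  ring

/-! ### Functions vanishing on the unit circle in the mean -/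

/-- A continuous function on the disc whose modulus has mean tending to `0` over the circles
`|x| = r`, `r → 1`. -/
def VanishesAtCircle (a : Plane → ℝ) : Prop :=
  ContinuousOn a disc ∧
    Tendsto (fun r => circleAverage (fun z => |a (toPlane z)|) 0 r) (𝓝[<] 1) (𝓝 0)

lemma continuousOn_comp_toPlane_sphere {a : Plane → ℝ} (ha : ContinuousOn a disc) {r : ℝ}
    (hr : r < 1) : ContinuousOn (fun z => a (toPlane z)) (Metric.sphere 0 r) :=
  ha.comp toPlane.continuous.continuousOn fun z hz => by
    have : ‖z‖ = r := by simpa using hz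
    rw [mem_disc, LinearIsometryEquiv.norm_map, this]
    exact hr

namespace VanishesAtCircle

variable {a b : Plane → ℝ}

lemma of_le {C : ℝ} (ha : VanishesAtCircle a) (hb : ContinuousOn b disc)
    (h : ∀ x ∈ disc, |b x| ≤ C * |a x|) : VanishesAtCircle b := by
  refine ⟨hb, ?_⟩
  have hlim := ha.2.const_mul C
  rw [mul_zero] at hlim
  refine tendsto_of_tendsto_of_tendsto_of_le_of_le' tendsto_const_nhds hlim
    (Eventually.of_forall fun r => circleAverage_nonneg_of_nonneg fun z _ => abs_nonneg _) ?_
  filter_upwards [Ioo_mem_nhdsLT (zero_lt_one' ℝ)] with r hr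
  rw [← smul_eq_mul, ← circleAverage_fun_smul]
  refine circleAverage_mono
    ((continuousOn_comp_toPlane_sphere hb hr.2).abs.circleIntegrable hr.1.le)
    (((continuousOn_comp_toPlane_sphere ha.1 hr.2).abs.const_smul C).circleIntegrable hr.1.le)
    fun z hz => ?_
  have hz' : ‖z‖ = r := by simpa [abs_of_pos hr.1] using hz
  exact h _ (by rw [mem_disc, LinearIsometryEquiv.norm_map, hz']; exact hr.2)

lemma add (ha : VanishesAtCircle a) (hb : VanishesAtCircle b) :
    VanishesAtCircle fun x => a x + b x := by
  refine ⟨ha.1.add hb.1, ?_⟩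
  have hlim := ha.2.add hb.2
  rw [add_zero] at hlim
  refine tendsto_of_tendsto_of_tendsto_of_le_of_le' tendsto_const_nhds hlim
    (Eventually.of_forall fun r => circleAverage_nonneg_of_nonneg fun z _ => abs_nonneg _) ?_
  filter_upwards [Ioo_mem_nhdsLT (zero_lt_one' ℝ)] with r hr
  have h1 := continuousOn_comp_toPlane_sphere ha.1 hr.2
  have h2 := continuousOn_comp_toPlane_sphere hb.1 hr.2
  rw [← circleAverage_fun_add (h1.abs.circleIntegrable hr.1.le) (h2.abs.circleIntegrable hr.1.le)]
  exact circleAverage_mono ((h1.add h2).abs.circleIntegrable hr.1.le)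
    ((h1.abs.add h2.abs).circleIntegrable hr.1.le) fun z _ => abs_add_le _ _

lemma const_mul (ha : VanishesAtCircle a) (c : ℝ) : VanishesAtCircle fun x => c * a x :=
  ha.of_le (C := |c|) (continuousOn_const.mul ha.1) fun _ _ => (abs_mul _ _).le

lemma sub (ha : VanishesAtCircle a) (hb : VanishesAtCircle b) :
    VanishesAtCircle fun x => a x - b x := by
  simpa [sub_eq_add_neg] using ha.add (hb.const_mul (-1))

lemma coord_mul (ha : VanishesAtCircle a) (j : Fin 2) : VanishesAtCircle fun x => x j * a x :=
  ha.of_le (C := 1) ((continuousOn_coord continuousOn_id j).mul ha.1) fun x hx => by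
    rw [abs_mul]
    gcongr
    exact (PiLp.norm_apply_le x j).trans (mem_disc.1 hx).le

lemma greenOp {h : Plane → ℝ} (hc : ContinuousOn h disc) (hi : IntegrableOn h disc) :
    VanishesAtCircle (greenOp h) :=
  ⟨continuousOn_greenOp hc hi, tendsto_circleAverage_abs_greenOp hc hi⟩

end VanishesAtCircle

/-- Circle means of a function that is continuous on the closed disc converge to the boundary
mean. -/
lemma tendsto_circleAverage_of_continuousOn {a : Plane → ℝ} (ha : ContinuousOn a (closure disc)) :
    Tendsto (fun r => circleAverage (fun z => a (toPlane z)) 0 r) (𝓝[<] 1)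
      (𝓝 (circleAverage (fun z => a (toPlane z)) 0 1)) := by
  have h1 : ContinuousOn (fun z => a (toPlane z)) {z | ‖z - 0‖ ∈ Icc (0 : ℝ) 1} := by
    refine ha.comp toPlane.continuous.continuousOn fun z hz => ?_
    rw [disc, closure_ball _ one_ne_zero, mem_closedBall_zero_iff, LinearIsometryEquiv.norm_map]
    simpa using hz.2
  have h2 := h1.circleAverage (fun r hr => hr.1)
  have h3 := (h2 1 (by simp)).tendsto
  refine h3.mono_left (nhdsWithin_le_of_mem ?_)
  exact mem_of_superset (Ioo_mem_nhdsLT (zero_lt_one' ℝ)) fun r hr => ⟨hr.1.le, hr.2.le⟩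

lemma VanishesAtCircle.of_boundary {a : Plane → ℝ} (ha : ContinuousOn a (closure disc))
    (h0 : ∀ x ∈ frontier disc, a x = 0) : VanishesAtCircle a := by
  refine ⟨ha.mono subset_closure, ?_⟩
  have h1 := tendsto_circleAverage_of_continuousOn ha.abs
  have h2 : circleAverage (fun z => |a (toPlane z)|) 0 1 = 0 := by
    refine circleAverage_const_on_circle fun z hz => ?_
    rw [h0 _ ?_, abs_zero]
    rw [disc, frontier_ball _ one_ne_zero]
    simpa using hz
  rwa [h2] at h1

lemma circleAverage_eq_boundaryIntegral (F : Plane → ℝ) :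
    circleAverage (fun z => F (toPlane z)) 0 1 = (2 * π)⁻¹ * boundaryIntegral F := by
  have h : ∀ θ, toPlane (circleMap 0 1 θ) = !₂[Real.cos θ, Real.sin θ] := by
    intro θ
    ext i
    fin_cases i <;> simp [circleMap, Complex.exp_ofReal_mul_I_re, Complex.exp_ofReal_mul_I_im]
  rw [circleAverage_def, boundaryIntegral, smul_eq_mul]
  simp only [h]

/-! ### The representation of the flux -/

lemma pd_eq_fderiv_comp_toPlane {a : Plane → ℝ} {x : Plane} (ha : DifferentiableAt ℝ a x)
    (v : ℂ) : fderiv ℝ (a ∘ toPlane) (toPlane.symm x) v = fderiv ℝ a x (toPlane v) := by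
  have h1 : HasFDerivAt a (fderiv ℝ a x) (toPlane (toPlane.symm x)) := by
    rw [toPlane.apply_symm_apply]; exact ha.hasFDerivAt
  rw [(h1.comp _ toPlane.toContinuousLinearEquiv.hasFDerivAt).fderiv]
  rfl

/-- The real-variable form of `fderiv_add_fderiv_of_boundary`, with distributional hypotheses: if
`H` and `E₀`, `E₁` are weakly harmonic and `Eⱼ = c xⱼ H` on the unit circle in the mean, then
`div E = c (H + x · ∇H + H(0))`. -/
lemma pd_add_pd_of_boundary {H : Plane → ℝ} {E : Fin 2 → Plane → ℝ} {c : ℝ}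
    (hHc : ContinuousOn H disc) (hH : WeakLap H fun _ => 0)
    (hEc : ∀ j, ContinuousOn (E j) disc) (hE : ∀ j, WeakLap (E j) fun _ => 0)
    (hb : ∀ j, VanishesAtCircle fun x => E j x - c * (x j * H x)) {x : Plane} (hx : x ∈ disc)
    (hHd : DifferentiableAt ℝ H x) (hEd : ∀ j, DifferentiableAt ℝ (E j) x) :
    pd 0 (E 0) x + pd 1 (E 1) x = c * (H x + inner ℝ x (gradient H x) + H 0) := by
  have hw : toPlane.symm x ∈ Metric.ball (0 : ℂ) 1 := by
    rw [← toPlane_mem_disc, toPlane.apply_symm_apply]; exact hx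
  have h0 := (hb 0).2
  have h1 := (hb 1).2
  simp only [toPlane_zero_apply] at h0
  simp only [toPlane_one_apply] at h1
  have key := fderiv_add_fderiv_of_boundary (hH.harmonicOnNhd hHc)
    ((hE 0).harmonicOnNhd (hEc 0)) ((hE 1).harmonicOnNhd (hEc 1)) h0 h1 hw
  rw [pd_eq_fderiv_comp_toPlane (hEd 0), pd_eq_fderiv_comp_toPlane (hEd 1),
    pd_eq_fderiv_comp_toPlane hHd, toPlane_one, toPlane_I, toPlane.apply_symm_apply,
    fderiv_self_eq_inner] at key
  simpa [pd] using key

/-- A weakly harmonic function that differs from `F` by a function vanishing on the circle has at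
the origin the boundary mean of `F`. -/
lemma apply_zero_eq_boundaryIntegral {H F : Plane → ℝ} (hHc : ContinuousOn H disc)
    (hH : WeakLap H fun _ => 0) (hF : ContinuousOn F (closure disc))
    (hFH : VanishesAtCircle fun x => F x - H x) : H 0 = (2 * π)⁻¹ * boundaryIntegral F := by
  have hharm := hH.harmonicOnNhd hHc
  have hFd : ContinuousOn F disc := hF.mono subset_closure
  rw [← circleAverage_eq_boundaryIntegral]
  have h1 := tendsto_circleAverage_of_continuousOn hF
  have h2 : Tendsto (fun r => circleAverage (fun z => F (toPlane z)) 0 r - H 0) (𝓝[<] 1)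
      (𝓝 0) := by
    refine squeeze_zero_norm' ?_ hFH.2
    filter_upwards [Ioo_mem_nhdsLT (zero_lt_one' ℝ)] with r hr
    have h3 : circleAverage (fun z => H (toPlane z)) 0 r = H 0 := by
      have h4 : InnerProductSpace.HarmonicOnNhd (H ∘ toPlane) (Metric.closedBall 0 |r|) := by
        rw [abs_of_pos hr.1]
        exact hharm.mono (Metric.closedBall_subset_ball hr.2)
      have h5 := h4.circleAverage_eq
      simpa [Function.comp_def] using h5
    rw [← h3, ← circleAverage_fun_sub
      ((continuousOn_comp_toPlane_sphere hFd hr.2).circleIntegrable hr.1.le)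
      ((continuousOn_comp_toPlane_sphere hHc hr.2).circleIntegrable hr.1.le)]
    exact abs_circleAverage_le_circleAverage_abs
  have h3 := tendsto_nhds_unique h2 (h1.sub_const (H 0))
  linarith

end LameDisc

open MeasureTheory Set Real

theorem lemma2p2 (μ lam : ℝ) (hμ : 0 < μ) (hlam : 0 ≤ μ + lam)
    (u f : Plane → Plane) (g F : Plane → ℝ)
    (hg : ContDiffOn ℝ 1 g disc)
    (hf : ContDiffOn ℝ 1 f disc)
    (hg_int : MeasureTheory.IntegrableOn (gradient g) disc)
    (hf_int : MeasureTheory.IntegrableOn f disc)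
    (hdivf_int : MeasureTheory.IntegrableOn (divergence f) disc)
    (hu : IsLameSolution μ lam u g f)
    (hF : IsEffectiveViscousFlux μ lam u g F) :
    ∀ x ∈ disc,
      GreenRegularAt (gradient g) x ∧
      GreenRegularAt f x ∧
      GreenRegularAt (fun y => divergence f y • y) x ∧
      GreenRegularAt (divergence f) x ∧
      F x = 2 * μ / (2 * μ + lam) * pressurePart g x + boundaryPart μ lam F
        + sourcePart μ lam f x := by
  have hfj : ∀ j : Fin 2, ContDiffOn ℝ 1 (fun y => f y j) disc := contDiffOn_coord hf
  have huj : ∀ j : Fin 2, ContDiffOn ℝ 2 (fun y => u y j) disc := contDiffOn_coord hu.contDiffOn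
  have hgradc : ContinuousOn (gradient g) disc :=
    (InnerProductSpace.toDual ℝ Plane).symm.continuous.comp_continuousOn
      (hg.continuousOn_fderiv_of_isOpen isOpen_disc (by norm_num))
  have hdivf : ∀ y ∈ disc, divergence f y = ∑ i, pd i (fun y => f y i) y := fun y hy => by
    rw [divergence_eq (ContDiffOn.differentiableAt_disc hf (by norm_num) hy), Fin.sum_univ_two]
  have hdivfc : ContinuousOn (divergence f) disc :=
    (continuousOn_finsetSum _ fun i _ =>
      (contDiffOn_pd (m := 0) (hfj i) (by norm_num)).continuousOn).congr hdivf
  have hxdc : ContinuousOn (fun y => divergence f y • y) disc := hdivfc.smul continuousOn_id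
  have hxdi : IntegrableOn (fun y => divergence f y • y) disc := by
    refine Integrable.mono hdivf_int (hdivf_int.1.smul aestronglyMeasurable_id) ?_
    filter_upwards [ae_restrict_mem isOpen_disc.measurableSet] with y hy
    rw [norm_smul]
    exact mul_le_of_le_one_right (norm_nonneg _) (mem_disc.1 hy).le
  have hdivu : ∀ y ∈ disc, divergence u y = ∑ i, pd i (fun y => u y i) y := fun y hy => by
    rw [divergence_eq (ContDiffOn.differentiableAt_disc hu.contDiffOn (by norm_num) hy),
      Fin.sum_univ_two]
  have hdivu1 : ContDiffOn ℝ 1 (divergence u) disc :=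
    (ContDiffOn.sum fun i _ => contDiffOn_pd (huj i) (by norm_num)).congr hdivu
  have hF1 : ContDiffOn ℝ 1 F disc :=
    ((contDiffOn_const.mul hdivu1).sub hg).congr hF.eq_flux
  have hpdF : ∀ (j : Fin 2), ∀ y ∈ disc,
      pd j F y = (μ + lam) * pd j (divergence u) y - pd j g y := by
    intro j y hy
    have hd := ContDiffOn.differentiableAt_disc hdivu1 (by norm_num) hy
    rw [pd_congr (Filter.mem_of_superset (disc_mem_nhds hy) hF.eq_flux),
      pd_sub (hd.const_mul _) (ContDiffOn.differentiableAt_disc hg (by norm_num) hy),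
      pd_const_mul _ hd]
  -- The Lamé system in components.
  have hlame : ∀ (j : Fin 2), ∀ y ∈ disc,
      μ * lap (fun y => u y j) y + lam * pd j (divergence u) y = pd j g y + f y j := by
    intro j y hy
    have h := congrArg (fun v : Plane => v j) (hu.equation y hy)
    simpa [gradient_apply,
      laplacian_apply ((hu.contDiffOn y hy).contDiffAt (disc_mem_nhds hy))] using h
  have hWF : WeakLap F (divergence f) := by
    refine (weakLap_of_gradient_eq (μ := μ) huj hfj hF1 fun i y hy => ?_).congr_right
      fun y hy => (hdivf y hy).symm
    rw [← pd_congr (Filter.mem_of_superset (disc_mem_nhds hy) hdivu), hpdF i y hy]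
    linarith [hlame i y hy]
  -- The harmonic part of the flux.
  set G₀ := greenOp (divergence f) with hG₀
  have hG₀c : ContinuousOn G₀ disc := continuousOn_greenOp hdivfc hdivf_int
  have hG₀v : VanishesAtCircle G₀ := VanishesAtCircle.greenOp hdivfc hdivf_int
  set H : Plane → ℝ := fun y => F y - G₀ y with hH
  have hHc : ContinuousOn H disc := hF1.continuousOn.sub hG₀c
  have hWH : WeakLap H fun _ => 0 :=
    (hWF.sub (weakLap_greenOp hdivf_int) hF1.continuousOn hG₀c hdivfc hdivfc).congr_right
      fun y _ => sub_self _
  have hH0 : H 0 = (2 * π)⁻¹ * boundaryIntegral F :=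
    apply_zero_eq_boundaryIntegral hHc hWH hF.continuousOn (by simpa [hH] using hG₀v)
  -- The components of `μ (μ + λ) u - μ G(∇g) - (μ + λ) G(f) + (λ / 2) (x F - G(x div f))`.
  set Gg : Fin 2 → Plane → ℝ := fun j => greenOp fun y => gradient g y j with hGg
  set Gf : Fin 2 → Plane → ℝ := fun j => greenOp fun y => f y j with hGf
  set Gx : Fin 2 → Plane → ℝ := fun j => greenOp fun y => (divergence f y • y) j with hGx
  have hgj : ∀ j, ContinuousOn (fun y => gradient g y j) disc := continuousOn_coord hgradc
  have hxj : ∀ j, ContinuousOn (fun y => (divergence f y • y) j) disc := continuousOn_coord hxdc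
  have hgji : ∀ j, IntegrableOn (fun y => gradient g y j) disc := integrableOn_coord hg_int
  have hfji : ∀ j, IntegrableOn (fun y => f y j) disc := integrableOn_coord hf_int
  have hxji : ∀ j, IntegrableOn (fun y => (divergence f y • y) j) disc := integrableOn_coord hxdi
  have hGgc : ∀ j, ContinuousOn (Gg j) disc := fun j => continuousOn_greenOp (hgj j) (hgji j)
  have hGfc : ∀ j, ContinuousOn (Gf j) disc := fun j =>
    continuousOn_greenOp (hfj j).continuousOn (hfji j)
  have hGxc : ∀ j, ContinuousOn (Gx j) disc := fun j => continuousOn_greenOp (hxj j) (hxji j)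
  have hcoord : ∀ j : Fin 2, ContinuousOn (fun y : Plane => y j) disc :=
    continuousOn_coord continuousOn_id
  have hlapc : ∀ j, ContinuousOn (lap fun y => u y j) disc := fun j =>
    continuousOn_finsetSum _ fun i _ => (contDiffOn_pd (m := 0)
      (contDiffOn_pd (m := 1) (huj j) (by norm_num)) (by norm_num)).continuousOn
  have hpdFc : ∀ j, ContinuousOn (pd j F) disc := fun j =>
    (contDiffOn_pd (m := 0) hF1 (by norm_num)).continuousOn
  set E : Fin 2 → Plane → ℝ := fun j y => (((μ + lam) * μ) * u y j - μ * Gg j y)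
    - (μ + lam) * Gf j y + lam / 2 * (y j * F y - Gx j y) with hE
  have hWE : ∀ j, WeakLap (E j) fun _ => 0 := by
    intro j
    have w1 := (weakLap_lap (huj j)).const_mul ((μ + lam) * μ)
    have w2 := (weakLap_greenOp (hgji j)).const_mul μ
    have w3 := (weakLap_greenOp (hfji j)).const_mul (μ + lam)
    have w4 := hWF.coord_mul hF1 hdivfc j
    have w5 := weakLap_greenOp (hxji j)
    have cu : ContinuousOn (fun y => (μ + lam) * μ * u y j) disc :=
      continuousOn_const.mul (huj j).continuousOn
    have cl : ContinuousOn (fun y => (μ + lam) * μ * lap (fun y => u y j) y) disc :=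
      continuousOn_const.mul (hlapc j)
    have cg := (continuousOn_const (c := μ)).mul (hgj j)
    have cG := (continuousOn_const (c := μ)).mul (hGgc j)
    have cf := (continuousOn_const (c := μ + lam)).mul (hfj j).continuousOn
    have cGf := (continuousOn_const (c := μ + lam)).mul (hGfc j)
    have cF := (hcoord j).mul hF1.continuousOn
    have cR : ContinuousOn (fun y => 2 * pd j F y + y j * divergence f y) disc :=
      (continuousOn_const.mul (hpdFc j)).add ((hcoord j).mul hdivfc)
    refine ((((w1.sub w2 cu cG cl cg).sub w3 (cu.sub cG) cGf (cl.sub cg) cf).add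
      ((w4.sub w5 cF (hGxc j) cR (hxj j)).const_mul (lam / 2)) ((cu.sub cG).sub cGf)
      (continuousOn_const.mul (cF.sub (hGxc j))) ((cl.sub cg).sub cf)
      (continuousOn_const.mul (cR.sub (hxj j))))).congr_right fun y hy => ?_
    have h1 := hlame j y hy
    have h2 := hpdF j y hy
    simp only [PiLp.smul_apply, smul_eq_mul, gradient_apply]
    rw [h2]
    linear_combination (μ + lam) * h1
  have hEv : ∀ j, VanishesAtCircle fun y => E j y - lam / 2 * (y j * H y) := by
    intro j
    have v1 : VanishesAtCircle fun y => u y j :=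
      VanishesAtCircle.of_boundary (continuousOn_coord hu.continuousOn j) fun y hy => by
        simp [hu.boundary y hy]
    have v2 := VanishesAtCircle.greenOp (hgj j) (hgji j)
    have v3 := VanishesAtCircle.greenOp (hfj j).continuousOn (hfji j)
    have v4 := VanishesAtCircle.greenOp (hxj j) (hxji j)
    have v5 := (((v1.const_mul ((μ + lam) * μ)).sub (v2.const_mul μ)).sub
      (v3.const_mul (μ + lam))).add (((hG₀v.coord_mul j).sub v4).const_mul (lam / 2))
    refine cast (congrArg VanishesAtCircle (funext fun y => ?_)) v5
    simp only [hE, hH, hGg, hGf, hGx]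
    ring
  have hEc : ∀ j, ContinuousOn (E j) disc := fun j =>
    (((continuousOn_const.mul (huj j).continuousOn).sub (continuousOn_const.mul (hGgc j))).sub
      (continuousOn_const.mul (hGfc j))).add
      (continuousOn_const.mul (((hcoord j).mul hF1.continuousOn).sub (hGxc j)))
  intro x hx
  have rg := greenRegularAt hgradc hg_int hx
  have rf := greenRegularAt hf.continuousOn hf_int hx
  have rx := greenRegularAt hxdc hxdi hx
  have dG₀ : DifferentiableAt ℝ G₀ x := differentiableAt_greenOp hdivfc hdivf_int hx
  refine ⟨rg, rf, rx, ⟨integrableOn_green_mul hdivfc hdivf_int hx, dG₀⟩, ?_⟩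
  have dF : DifferentiableAt ℝ F x := ContDiffOn.differentiableAt_disc hF1 (by norm_num) hx
  have du : ∀ j, DifferentiableAt ℝ (fun y => u y j) x := fun j =>
    ContDiffOn.differentiableAt_disc (huj j) (by norm_num) hx
  have dGg : ∀ j, DifferentiableAt ℝ (Gg j) x := fun j =>
    differentiableAt_greenOp (hgj j) (hgji j) hx
  have dGf : ∀ j, DifferentiableAt ℝ (Gf j) x := fun j =>
    differentiableAt_greenOp (hfj j).continuousOn (hfji j) hx
  have dGx : ∀ j, DifferentiableAt ℝ (Gx j) x := fun j =>
    differentiableAt_greenOp (hxj j) (hxji j) hx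
  have dc : ∀ j : Fin 2, DifferentiableAt ℝ (fun y : Plane => y j) x := fun j =>
    (EuclideanSpace.proj j : Plane →L[ℝ] ℝ).differentiableAt
  have d1 : ∀ j, DifferentiableAt ℝ (fun y => (μ + lam) * μ * u y j - μ * Gg j y) x :=
    fun j => ((du j).const_mul ((μ + lam) * μ)).sub ((dGg j).const_mul μ)
  have d2 : ∀ j, DifferentiableAt ℝ
      (fun y => (μ + lam) * μ * u y j - μ * Gg j y - (μ + lam) * Gf j y) x :=
    fun j => (d1 j).sub ((dGf j).const_mul (μ + lam))
  have dcF : ∀ j : Fin 2, DifferentiableAt ℝ (fun y : Plane => y j * F y) x :=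
    fun j => (dc j).mul dF
  have d3 : ∀ j, DifferentiableAt ℝ (fun y => y j * F y - Gx j y) x :=
    fun j => (dcF j).sub (dGx j)
  have d4 : ∀ j, DifferentiableAt ℝ (E j) x :=
    fun j => (d2 j).add ((d3 j).const_mul (lam / 2))
  have hpdE : ∀ j, pd j (E j) x = (((μ + lam) * μ) * pd j (fun y => u y j) x - μ * pd j (Gg j) x)
      - (μ + lam) * pd j (Gf j) x + lam / 2 * ((F x + x j * pd j F x) - pd j (Gx j) x) := by
    intro j
    simp only [hE]
    rw [pd_add (d2 j) ((d3 j).const_mul _), pd_sub (d1 j) ((dGf j).const_mul _),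
      pd_sub ((du j).const_mul _) ((dGg j).const_mul _), pd_const_mul _ (du j),
      pd_const_mul _ (dGg j), pd_const_mul _ (dGf j), pd_const_mul _ (d3 j),
      pd_sub (dcF j) (dGx j), pd_mul (dc j) dF, pd_coord, if_pos rfl, one_mul]
  have key := pd_add_pd_of_boundary hHc hWH hEc hWE hEv hx (dF.sub dG₀) d4
  have hHgrad : inner ℝ x (gradient H x)
      = x 0 * pd 0 F x + x 1 * pd 1 F x - inner ℝ x (gradient G₀ x) := by
    rw [← fderiv_self_eq_inner, ← fderiv_self_eq_inner, ← fderiv_self_eq_sum, hH,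
      fderiv_fun_sub dF dG₀]
    rfl
  rw [hpdE 0, hpdE 1, hHgrad, hH0] at key
  have eu := hdivu x hx
  rw [Fin.sum_univ_two] at eu
  have eF := hF.eq_flux x hx
  have eg : divergence (greenOp (gradient g)) x = pd 0 (Gg 0) x + pd 1 (Gg 1) x :=
    divergence_greenOp hgradc hg_int hx
  have ef : divergence (greenOp f) x = pd 0 (Gf 0) x + pd 1 (Gf 1) x :=
    divergence_greenOp hf.continuousOn hf_int hx
  have ex : divergence (greenOp (fun y => divergence f y • y)) x = pd 0 (Gx 0) x + pd 1 (Gx 1) x :=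
    divergence_greenOp hxdc hxdi hx
  have hpos : 2 * μ + lam ≠ 0 := by linarith
  have hπ := Real.pi_ne_zero
  have hHx : H x = F x - G₀ x := rfl
  rw [pressurePart, boundaryPart, sourcePart, eg, ef, ex, ← hG₀]
  rw [hHx] at key
  have hfin : (2 * μ + lam) * F x = 2 * μ * ((pd 0 (Gg 0) x + pd 1 (Gg 1) x) - g x)
      + lam * ((2 * π)⁻¹ * boundaryIntegral F) + 2 * (μ + lam) * (pd 0 (Gf 0) x + pd 1 (Gf 1) x)
      + lam * ((pd 0 (Gx 0) x + pd 1 (Gx 1) x) - inner ℝ x (gradient G₀ x) - G₀ x) := by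
    rw [eu] at eF
    linear_combination 2 * key + 2 * μ * eF
  rw [← mul_right_inj' hpos, hfin]
  field_simp
  ring
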